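/- Let $n\ge 0$, let $\Sigma$ be an oriented smooth $n$-manifold, $I\subset\mathbb R$ an interval with more than one point, and let $F:I\times\Sigma\to\mathbb R^{n+2}$ be a smooth family of immersions that solves the skew mean curvature flow $\partial_t F=J(F)\mathbf H(F)$, where $\mathbf H=\mathrm{tr}_g\mathbf A$ is the mean curvature vector, $\mathbf A$ the second fundamental form, $g$ the induced metric, and $J$ the rotation of the normal planes by $\pi/2$ in the positive sense. Let $U\subset\Sigma$ be open (for instance $U=\Sigma$, if global frames exist; in particular the normal bundle is then trivial). Let $e_1,\dots,e_n$ and $\nu_{n+1},\nu_{n+2}$ be smooth orthonormal frames over $I\times U$ of the tangent bundle $\mathcal H$ and of the normal bundle $\mathcal N$ of the immersions, in temporal gauge, that is, parallel in time: $(\partial_t e_i)^{\top}=0$ and $(\partial_t\nu_\alpha)^{\perp}=0$. Suppose that $J\nu_{n+1}=\nu_{n+2}$ on $U$ at some time $t_0\in I$. Put $h^\alpha_{ij}=\langle \mathbf A(e_i,e_j),\nu_\alpha\rangle$ and $H^\alpha=\sum_k h^\alpha_{kk}$. Let $\Delta_g h^\alpha_{ij}:=\langle(\Delta_g\mathbf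 A)(e_i,e_j),\nu_\alpha\rangle$, where $\Delta_g=\mathrm{tr}_g\nabla^2$ is the covariant Laplacian of $\mathbf A$ for the Levi-Civita connection of $g$ and the normal connection. Then on $I\times U$, for $1\le i,j\le n$ and with summation over repeated indices ($1\le m,k,l\le n$, $\beta\in\{n+1,n+2\}$), $$\begin{aligned}\partial_t h^{n+1}_{ij}={}&-\Delta_g h^{n+2}_{ij}-h^{n+2}_{im}(h^\beta_{mk}h^\beta_{kj}-h^\beta_{mj}H^\beta)-h^{n+2}_{mk}(h^\beta_{mk}h^\beta_{ij}-h^\beta_{ki}h^\beta_{mj})\\&-h^\beta_{ik}(h^\beta_{kl}h^{n+2}_{lj}-h^{n+2}_{kl}h^\beta_{lj})-H^{n+2}h^{n+1}_{ik}h^{n+1}_{jk}+H^{n+1}h^{n+1}_{ik}h^{n+2}_{jk},\end{aligned}$$ $$\begin{aligned}\partial_t h^{n+2}_{ij}={}&\Delta_g h^{n+1}_{ij}+h^{n+1}_{im}(h^\beta_{mk}h^\beta_{kj}-h^\beta_{mj}H^\beta)+h^{n+1}_{mk}(h^\beta_{mk}h^\beta_{ij}-h^\beta_{ki}h^\beta_{mj})\\&+h^\beta_{ik}(h^\beta_{kl}h^{n+1}_{lj}-h^{n+1}_{kl}h^\beta_{lj})-H^{n+2}h^{n+2}_{ik}h^{n+1}_{jk}+H^{n+1}h^{n+2}_{ik}h^{n+2}_{jk}.\end{aligned}$$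 In particular, the complex functions $\varphi_{ij}=h^{n+1}_{ij}+\mathrm i\,h^{n+2}_{ij}$, $\Phi=(\varphi_{ij})$, satisfy the Schrödinger system $$-\mathrm i\,\partial_t\Phi=\Delta_g\Phi+\Phi*\Phi*\Phi,\qquad \Delta_g\varphi_{ij}:=\Delta_g h^{n+1}_{ij}+\mathrm i\,\Delta_g h^{n+2}_{ij},$$ where $\Phi*\Phi*\Phi=T(\Phi,\Phi,\Phi)$ for an $\mathbb R$-trilinear map $T$ on the space of complex $n\times n$ matrices that depends only on $n$ (in the orthonormal frame the metric is $\delta_{ij}$, so that the coefficients are constants). -/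

import Mathlib

open scoped Manifold ContDiff

noncomputable section

namespace SkewMCF

/-- The ambient Euclidean space `ℝ^{n+2}`. -/
abbrev Amb (n : ℕ) : Type := EuclideanSpace ℝ (Fin (n + 2))

/-- A smooth atlas (charts with values in `ℝⁿ`) is oriented when all its coordinate changes have
positive Jacobian determinant. -/
class OrientedManifold (n : ℕ) (M : Type*) [TopologicalSpace M]
    [ChartedSpace (EuclideanSpace ℝ (Fin n)) M] : Prop where
  det_pos : ∀ c ∈ atlas (EuclideanSpace ℝ (Fin n)) M, ∀ c' ∈ atlas (EuclideanSpace ℝ (Fin n)) M,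
    ∀ p ∈ (c.symm.trans c').source,
      0 < (fderiv ℝ (fun q : EuclideanSpace ℝ (Fin n) => c' (c.symm q)) p).det

section Static

variable {n : ℕ} {M : Type*} [TopologicalSpace M] [ChartedSpace (EuclideanSpace ℝ (Fin n)) M]

/-- The differential `df_x : T_xM → ℝ^{n+2}`. -/
def differential (f : M → Amb n) (x : M) : TangentSpace (𝓡 n) x →L[ℝ] Amb n :=
  mfderiv (𝓡 n) 𝓘(ℝ, Amb n) f x

/-- The coordinate vector `∂_k` at `x` of the preferred chart at `x`. In Mathlib, `T_xM` is the
model space `ℝⁿ`, read through that chart. -/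
def coordVec (x : M) (k : Fin n) : TangentSpace (𝓡 n) x :=
  (EuclideanSpace.single k (1 : ℝ) : EuclideanSpace ℝ (Fin n))

/-- The Gram matrix `g_{ij} = ⟨∂_i f, ∂_j f⟩` of the induced metric. -/
def metric (f : M → Amb n) (x : M) : Matrix (Fin n) (Fin n) ℝ :=
  Matrix.of fun i j =>
    inner ℝ (differential f x (coordVec x i)) (differential f x (coordVec x j))

/-- The tangent vector `g^{kl} ⟨v, ∂_l f⟩ ∂_k` of `M`, whose image under `df_x` is the orthogonal
projection of `v` to `df_x(T_xM)` when `f` is an immersion. -/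
def tangentComp (f : M → Amb n) (x : M) (v : Amb n) : TangentSpace (𝓡 n) x :=
  ∑ k, ∑ l, ((metric f x)⁻¹ k l * inner ℝ v (differential f x (coordVec x l))) • coordVec x k

/-- The normal part `v^⊥`. -/
def normalPart (f : M → Amb n) (x : M) (v : Amb n) : Amb n :=
  v - differential f x (tangentComp f x v)

/-- The second fundamental form `A(u, v) = (u^i v^j ∂²f/∂x_i∂x_j)^⊥` at `x`. -/
def secondFF (f : M → Amb n) (x : M) (u v : TangentSpace (𝓡 n) x) : Amb n :=
  normalPart f x
    (fderiv ℝ (fderiv ℝ (f ∘ (extChartAt (𝓡 n) x).symm)) (extChartAt (𝓡 n) x x) u v)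

/-- The mean curvature vector `H = tr_g A`. -/
def meanCurvature (f : M → Amb n) (x : M) : Amb n :=
  ∑ i, ∑ j, (metric f x)⁻¹ i j • secondFF f x (coordVec x i) (coordVec x j)

/-- The rotation by `π/2` of the normal space in the positive sense: `⟨J v, w⟩` is the
Euclidean volume `det(∂_1 f, …, ∂_n f, v, w) / √(det g)`. Thus `J` kills tangent vectors, and a unit
normal vector `v` goes to the unit normal vector `J v` orthogonal to `v` for which
`∂_1 f, …, ∂_n f, v, J v` is a positive basis of `ℝ^{n+2}`. -/
def rotJ (f : M → Amb n) (x : M) (v : Amb n) : Amb n :=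
  WithLp.toLp 2 fun a : Fin (n + 2) =>
    (Real.sqrt (metric f x).det)⁻¹ *
      Matrix.det (Matrix.of fun r c : Fin (n + 2) =>
        ((Fin.snoc
            (Fin.snoc (fun i : Fin n => differential f x (coordVec x i)) v : Fin (n + 1) → Amb n)
            (EuclideanSpace.single a (1 : ℝ)) : Fin (n + 2) → Amb n) r) c)

/-- The derivative `D_X ξ` of an `ℝ^{n+2}`-valued function along a vector field. -/
def dirDeriv (X : (x : M) → TangentSpace (𝓡 n) x) (ξ : M → Amb n) (x : M) : Amb n :=
  differential ξ x (X x)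

/-- The Levi-Civita connection of the induced metric, `df(∇_X Y) = (D_X (df Y))^⊤`. -/
def leviCivita (f : M → Amb n) (X Y : (x : M) → TangentSpace (𝓡 n) x) (x : M) :
    TangentSpace (𝓡 n) x :=
  tangentComp f x (dirDeriv X (fun y => differential f y (Y y)) x)

/-- The normal connection `∇^⊥_X ξ = (D_X ξ)^⊥`. -/
def normalConn (f : M → Amb n) (X : (x : M) → TangentSpace (𝓡 n) x) (ξ : M → Amb n) (x : M) :
    Amb n :=
  normalPart f x (dirDeriv X ξ x)

/-- The covariant derivative `(∇_Z A)(X, Y)` of the second fundamental form. -/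
def nablaA (f : M → Amb n) (Z X Y : (x : M) → TangentSpace (𝓡 n) x) (x : M) : Amb n :=
  normalConn f Z (fun y => secondFF f y (X y) (Y y)) x
    - secondFF f x (leviCivita f Z X x) (Y x)
    - secondFF f x (X x) (leviCivita f Z Y x)

/-- The second covariant derivative `(∇²_{W,Z} A)(X, Y)` of the second fundamental form. -/
def nabla2A (f : M → Amb n) (W Z X Y : (x : M) → TangentSpace (𝓡 n) x) (x : M) : Amb n :=
  normalConn f W (nablaA f Z X Y) x
    - nablaA f (leviCivita f W Z) X Y x
    - nablaA f Z (leviCivita f W X) Y x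
    - nablaA f Z X (leviCivita f W Y) x

/-- The covariant Laplacian `(Δ_g A)(X, Y) = tr_g ∇² A (X, Y)`, with the trace taken in
the orthonormal frame `e`. -/
def laplaceA (f : M → Amb n) (e : Fin n → (x : M) → TangentSpace (𝓡 n) x)
    (X Y : (x : M) → TangentSpace (𝓡 n) x) (x : M) : Amb n :=
  ∑ k, nabla2A f (e k) (e k) X Y x

end Static

section Flow

variable {n : ℕ} {M : Type*} [TopologicalSpace M] [ChartedSpace (EuclideanSpace ℝ (Fin n)) M]

/-- `F : I × M → ℝ^{n+2}` is a smooth family of immersions that solves the skew mean curvature flow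
`∂F/∂t = J(F) H(F)` (one-sided time derivative at an end point of `I`). -/
structure IsSMCF (I : Set ℝ) (F : ℝ → M → Amb n) : Prop where
  smooth : ContMDiffOn (𝓘(ℝ, ℝ).prod (𝓡 n)) 𝓘(ℝ, Amb n) ∞
    (fun p : ℝ × M => F p.1 p.2) (I ×ˢ Set.univ)
  immersion : ∀ t ∈ I, ∀ x, Function.Injective (differential (F t) x)
  flow : ∀ t ∈ I, ∀ x,
    HasDerivWithinAt (fun s => F s x) (rotJ (F t) x (meanCurvature (F t) x)) I t

/-- Temporal gauge over `I × U`: a smooth frame `dF(e_1), …, dF(e_n), ν_0, ν_1`, which consists of an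
orthonormal frame of the tangent bundle and one of the normal bundle, both parallel in time
for the induced connections; at some time `ν_1 = J ν_0`. -/
structure IsTemporalGauge (I : Set ℝ) (U : Set M) (F : ℝ → M → Amb n)
    (e : Fin n → ℝ → (x : M) → TangentSpace (𝓡 n) x) (ν : Fin 2 → ℝ → M → Amb n) : Prop where
  smooth_tangent : ∀ i, ContMDiffOn (𝓘(ℝ, ℝ).prod (𝓡 n)) 𝓘(ℝ, Amb n) ∞
    (fun p : ℝ × M => differential (F p.1) p.2 (e i p.1 p.2)) (I ×ˢ U)
  smooth_normal : ∀ α, ContMDiffOn (𝓘(ℝ, ℝ).prod (𝓡 n)) 𝓘(ℝ, Amb n) ∞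
    (fun p : ℝ × M => ν α p.1 p.2) (I ×ˢ U)
  orthonormal_tangent : ∀ t ∈ I, ∀ x ∈ U,
    Orthonormal ℝ fun i => differential (F t) x (e i t x)
  orthonormal_normal : ∀ t ∈ I, ∀ x ∈ U, Orthonormal ℝ fun α => ν α t x
  normal : ∀ t ∈ I, ∀ x ∈ U, ∀ α, ∀ w, inner ℝ (ν α t x) (differential (F t) x w) = 0
  parallel_tangent : ∀ t ∈ I, ∀ x ∈ U, ∀ i, tangentComp (F t) x
    (derivWithin (fun s => differential (F s) x (e i s x)) I t) = 0
  parallel_normal : ∀ t ∈ I, ∀ x ∈ U, ∀ α, normalPart (F t) x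
    (derivWithin (fun s => ν α s x) I t) = 0
  oriented : ∃ t₀ ∈ I, ∀ x ∈ U, rotJ (F t₀) x (ν 0 t₀ x) = ν 1 t₀ x

/-- The coefficients `h^α_{ij} = ⟨A(e_i, e_j), ν_α⟩` at `(t, x)`; `α = 0, 1` stands for
`n+1, n+2`. -/
def coeffA (F : ℝ → M → Amb n) (e : Fin n → ℝ → (x : M) → TangentSpace (𝓡 n) x)
    (ν : Fin 2 → ℝ → M → Amb n) (t : ℝ) (x : M) (α : Fin 2) (i j : Fin n) : ℝ :=
  inner ℝ (secondFF (F t) x (e i t x) (e j t x)) (ν α t x)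

/-- The coefficients `Δ_g h^α_{ij} = ⟨(Δ_g A)(e_i, e_j), ν_α⟩` of the covariant Laplacian of the
second fundamental form. -/
def lapCoeffA (F : ℝ → M → Amb n) (e : Fin n → ℝ → (x : M) → TangentSpace (𝓡 n) x)
    (ν : Fin 2 → ℝ → M → Amb n) (t : ℝ) (x : M) (α : Fin 2) (i j : Fin n) : ℝ :=
  inner ℝ (laplaceA (F t) (fun k => e k t) (e i t) (e j t) x) (ν α t x)

/-- The complex functions `φ_{ij} = h^{n+1}_{ij} + i h^{n+2}_{ij}`. -/
def hasimoto (F : ℝ → M → Amb n) (e : Fin n → ℝ → (x : M) → TangentSpace (𝓡 n) x)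
    (ν : Fin 2 → ℝ → M → Amb n) (t : ℝ) (x : M) : Matrix (Fin n) (Fin n) ℂ :=
  Matrix.of fun i j => (coeffA F e ν t x 0 i j : ℂ) + Complex.I * (coeffA F e ν t x 1 i j : ℂ)

/-- `Δ_g φ_{ij} = Δ_g h^{n+1}_{ij} + i Δ_g h^{n+2}_{ij}`. -/
def lapHasimoto (F : ℝ → M → Amb n) (e : Fin n → ℝ → (x : M) → TangentSpace (𝓡 n) x)
    (ν : Fin 2 → ℝ → M → Amb n) (t : ℝ) (x : M) : Matrix (Fin n) (Fin n) ℂ :=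
  Matrix.of fun i j =>
    (lapCoeffA F e ν t x 0 i j : ℂ) + Complex.I * (lapCoeffA F e ν t x 1 i j : ℂ)

end Flow

/-- The trace `H^α = ∑_k h^α_{kk}`. -/
def traceH {n : ℕ} (h : Fin 2 → Fin n → Fin n → ℝ) (α : Fin 2) : ℝ := ∑ k, h α k k

/-- With summation over `m, k, l, β`, the cubic expression
`h^α_{im}(h^β_{mk} h^β_{kj} - h^β_{mj} H^β) + h^α_{mk}(h^β_{mk} h^β_{ij} - h^β_{ki} h^β_{mj})
  + h^β_{ik}(h^β_{kl} h^α_{lj} - h^α_{kl} h^β_{lj})`. -/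
def cubicQ {n : ℕ} (h : Fin 2 → Fin n → Fin n → ℝ) (α : Fin 2) (i j : Fin n) : ℝ :=
  (∑ m, h α i m * ∑ β, ((∑ k, h β m k * h β k j) - h β m j * traceH h β))
    + (∑ m, ∑ k, h α m k * ∑ β, (h β m k * h β i j - h β k i * h β m j))
    + ∑ β, ∑ k, h β i k * ∑ l, (h β k l * h α l j - h α k l * h β l j)

end SkewMCF

end

/-! Write `V = J H` for the velocity, a normal field. Splitting `∂_t(dF e_i) = D_{e_i}V + dF(∂_t
e_i)` into its tangential and normal parts, the temporal gauge forces `∂_t e_i = -(D_{e_i}V)^⊤` and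
`∂_t(dF e_i) = ∇^⊥_{e_i}V` (`hasDerivWithinAt_frame`). The gauge also makes `∂_t ν_α` tangent, and
differentiating `⟨dF e_m, ν_α⟩ = 0` determines it. The product rule for `h^α_{ij} = ⟨D_{e_i}(dF
e_j), ν_α⟩` then gives `∂_t h^α_{ij} = ⟨∇²_{ij}V, ν_α⟩ + ⟨V, A_{im}⟩ h^α_{mj}`
(`hasDerivWithinAt_coeffA`). The last term is already cubic in `h`.

The quarter turn of an oriented plane bundle is parallel for a metric connection, so `∇²V = J ∇²H`
(`hessian_quarterTurn`). Simons' identity writes `∇²H` as `ΔA` plus cubic terms (`laplaceA_eq`,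
`inner_laplaceA`). Finally `J` exchanges the two normal components and changes one sign; on `h^{n+1}
+ i h^{n+2}` this is multiplication by `i`, hence the Schrödinger form.

Simons' identity rests on the flatness of `ℝ^{n+2}`: ambient derivatives commute up to the bracket
`∇_X Y - ∇_Y X` (`dirDeriv_commutator`). The normal part of this fact contains Codazzi and Ricci,
the tangential part Gauss. Codazzi moves indices in `∇²A`, the commutator of `∇²A` produces the
cubic terms, and the trace passes through `∇` because the connection form of an orthonormal frame is
skew.

Two further points. The determinant that defines `J` fixes `⟨J ν_0, ν_1⟩` only up to sign at each
point (`inner_rotJ_sq`); the sign is continuous in time, hence stays `1` (`inner_rotJ_eq_one`). And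
the fields `e_i` are known to be smooth only through `dF(e_i)`; inverting the injective map `dF`
recovers smoothness of the fields themselves (`contDiffWithinAt_of_clm_apply`). -/

open scoped Manifold ContDiff

noncomputable section

namespace SkewMCF

/-! ### Smooth families of injective linear equations -/

section Solve

variable {P V A : Type*} [NormedAddCommGroup P] [NormedSpace ℝ P]
  [NormedAddCommGroup V] [NormedSpace ℝ V] [FiniteDimensional ℝ V]
  [NormedAddCommGroup A] [NormedSpace ℝ A] [FiniteDimensional ℝ A]

/-- The solution of a smooth family of linear equations with injective operators is smooth. -/
theorem contDiffWithinAt_of_clm_apply {k : WithTop ℕ∞} {s : Set P} {p : P} (hp : p ∈ s)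
    {L : P → V →L[ℝ] A} {ξ : P → A} {e : P → V} (hL : ContDiffWithinAt ℝ k L s p)
    (hξ : ContDiffWithinAt ℝ k ξ s p) (he : ∀ q ∈ s, L q (e q) = ξ q)
    (hinj : Function.Injective (L p)) : ContDiffWithinAt ℝ k e s p := by
  have := FiniteDimensional.complete ℝ V
  -- A left inverse at the single point `p` suffices: `g ∘ L q` stays invertible for `q` near `p`,
  -- since units are open, and there `e q = (g ∘ L q)⁻¹ (g (ξ q))`.
  obtain ⟨g, hg⟩ : ∃ g : A →L[ℝ] V, g ∘L L p = ContinuousLinearMap.id ℝ V := by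
    have h := ContinuousLinearMap.HasLeftInverse.of_injective_of_finiteDimensional hinj
    obtain ⟨g, hg⟩ := h
    exact ⟨g, by ext v; exact hg v⟩
  have h1 : ContDiffWithinAt ℝ k (fun q => g ∘L L q) s p := contDiffWithinAt_const.clm_comp hL
  have h2 : ContDiffWithinAt ℝ k (fun q => (g ∘L L q).inverse (g (ξ q))) s p := by
    refine ContDiffWithinAt.clm_apply ?_ (g.contDiff.contDiffAt.comp_contDiffWithinAt p hξ)
    have h3 : ContDiffAt ℝ k ContinuousLinearMap.inverse (g ∘L L p) := by
      rw [hg]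
      exact contDiffAt_map_inverse (ContinuousLinearEquiv.refl ℝ V)
    exact h3.comp_contDiffWithinAt p h1
  have hev : ∀ᶠ q in nhdsWithin p s, (g ∘L L q) ∈ {T : V →L[ℝ] V | IsUnit T} := by
    refine h1.continuousWithinAt.eventually_mem (Units.isOpen.mem_nhds ?_)
    change IsUnit (g ∘L L p)
    rw [hg]
    exact isUnit_one
  have hmem : ∀ᶠ q in nhdsWithin p s, q ∈ s := self_mem_nhdsWithin
  have heq : ∀ q ∈ s, IsUnit (g ∘L L q) → e q = (g ∘L L q).inverse (g (ξ q)) := by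
    intro q hq hu
    rw [← he q hq]
    have h4 : (g ∘L L q).IsInvertible := by
      obtain ⟨u, hu⟩ := hu
      exact ⟨ContinuousLinearEquiv.unitsEquiv ℝ V u, by rw [← hu]; rfl⟩
    exact (h4.inverse_apply_eq.mpr rfl).symm
  refine h2.congr_of_eventuallyEq ?_ (heq p hp ?_)
  · filter_upwards [hev, hmem] with q h1 h2 using heq q h2 h1
  · exact hev.self_of_nhdsWithin hp

end Solve

/-! ### Derivatives on the manifold, read in one chart -/

section Chart

variable {n : ℕ} {M : Type*} [TopologicalSpace M] [ChartedSpace (EuclideanSpace ℝ (Fin n)) M]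
  {G : Type*} [NormedAddCommGroup G] [NormedSpace ℝ G]

/-- The differential at `x` of a map from `M` to a normed space. -/
def tderiv (n : ℕ) [ChartedSpace (EuclideanSpace ℝ (Fin n)) M] (ξ : M → G) (x : M) : TangentSpace (𝓡 n) x →L[ℝ] G :=
  mfderiv (𝓡 n) 𝓘(ℝ, G) ξ x

theorem tderiv_congr {ξ η : M → G} {x : M} (h : ξ =ᶠ[nhds x] η) : tderiv n ξ x = tderiv n η x := by
  unfold tderiv
  exact h.mfderiv_eq

/-- The derivative at `x` is the derivative in the preferred chart. -/
theorem tderiv_eq_fderiv {ξ : M → G} {x : M} (h : MDifferentiableAt (𝓡 n) 𝓘(ℝ, G) ξ x) :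
    tderiv n ξ x =
      fderiv ℝ (ξ ∘ (extChartAt (𝓡 n) x).symm) (extChartAt (𝓡 n) x x) := by
  have h1 : tderiv n ξ x = fderivWithin ℝ (writtenInExtChartAt (𝓡 n) 𝓘(ℝ, G) x ξ)
      (Set.range (𝓡 n)) (extChartAt (𝓡 n) x x) := if_pos h
  have h2 : Set.range (𝓡 n) = Set.univ := by simp
  rw [h1, h2, fderivWithin_univ]
  rfl


section Rules

variable {ξ η : M → G} {x : M}

theorem mdifferentiableAt_iff_chart :
    MDifferentiableAt (𝓡 n) 𝓘(ℝ, G) ξ x ↔ ContinuousAt ξ x ∧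
      DifferentiableAt ℝ (ξ ∘ (extChartAt (𝓡 n) x).symm) (extChartAt (𝓡 n) x x) := by
  have h2 : Set.range (𝓡 n) = Set.univ := by simp
  rw [mdifferentiableAt_iff, h2, differentiableWithinAt_univ]
  rfl

theorem tderiv_add (hξ : MDifferentiableAt (𝓡 n) 𝓘(ℝ, G) ξ x)
    (hη : MDifferentiableAt (𝓡 n) 𝓘(ℝ, G) η x) :
    tderiv n (fun y => ξ y + η y) x = tderiv n ξ x + tderiv n η x :=
  mfderiv_add hξ hη

theorem tderiv_sub (hξ : MDifferentiableAt (𝓡 n) 𝓘(ℝ, G) ξ x)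
    (hη : MDifferentiableAt (𝓡 n) 𝓘(ℝ, G) η x) :
    tderiv n (fun y => ξ y - η y) x = tderiv n ξ x - tderiv n η x :=
  mfderiv_sub hξ hη

theorem tderiv_sum {ι : Type*} [Fintype ι] {ζ : ι → M → G}
    (hζ : ∀ k, MDifferentiableAt (𝓡 n) 𝓘(ℝ, G) (ζ k) x) :
    tderiv n (fun y => ∑ k, ζ k y) x = ∑ k, tderiv n (ζ k) x := by
  have h := fun k => mdifferentiableAt_iff_chart.1 (hζ k)
  have h1 : MDifferentiableAt (𝓡 n) 𝓘(ℝ, G) (fun y => ∑ k, ζ k y) x :=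
    mdifferentiableAt_iff_chart.2 ⟨tendsto_finsetSum _ fun k _ => (h k).1,
      DifferentiableAt.fun_sum fun k _ => (h k).2⟩
  rw [tderiv_eq_fderiv h1, Finset.sum_congr rfl fun k _ => tderiv_eq_fderiv (hζ k)]
  exact fderiv_fun_sum fun k _ => (h k).2

theorem tderiv_const (c : G) : tderiv n (fun _ : M => c) x = 0 :=
  mfderiv_const

theorem mdifferentiableAt_smul {a : M → ℝ} (ha : MDifferentiableAt (𝓡 n) 𝓘(ℝ, ℝ) a x)
    (hξ : MDifferentiableAt (𝓡 n) 𝓘(ℝ, G) ξ x) :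
    MDifferentiableAt (𝓡 n) 𝓘(ℝ, G) (fun y => a y • ξ y) x := by
  rw [mdifferentiableAt_iff_chart] at *
  exact ⟨ha.1.smul hξ.1, ha.2.smul hξ.2⟩

theorem tderiv_smul {a : M → ℝ} (ha : MDifferentiableAt (𝓡 n) 𝓘(ℝ, ℝ) a x)
    (hξ : MDifferentiableAt (𝓡 n) 𝓘(ℝ, G) ξ x) (v : TangentSpace (𝓡 n) x) :
    tderiv n (fun y => a y • ξ y) x v = tderiv n a x v • ξ x + a x • tderiv n ξ x v := by
  rw [tderiv_eq_fderiv ha, tderiv_eq_fderiv hξ, tderiv_eq_fderiv (mdifferentiableAt_smul ha hξ)]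
  have h := fderiv_smul (mdifferentiableAt_iff_chart.1 ha).2 (mdifferentiableAt_iff_chart.1 hξ).2
  have h1 := congrArg (fun L : EuclideanSpace ℝ (Fin n) →L[ℝ] G => L v) h
  refine h1.trans ?_
  simp only [Function.comp_apply, extChartAt_to_inv]
  exact add_comm _ _

end Rules

section InnerRules

variable {K : Type*} [NormedAddCommGroup K] [InnerProductSpace ℝ K] {ξ η : M → K} {x : M}

theorem mdifferentiableAt_inner (hξ : MDifferentiableAt (𝓡 n) 𝓘(ℝ, K) ξ x)
    (hη : MDifferentiableAt (𝓡 n) 𝓘(ℝ, K) η x) :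
    MDifferentiableAt (𝓡 n) 𝓘(ℝ, ℝ) (fun y => (inner ℝ (ξ y) (η y) : ℝ)) x := by
  rw [mdifferentiableAt_iff_chart] at *
  exact ⟨hξ.1.inner hη.1, hξ.2.inner ℝ hη.2⟩

theorem tderiv_inner (hξ : MDifferentiableAt (𝓡 n) 𝓘(ℝ, K) ξ x)
    (hη : MDifferentiableAt (𝓡 n) 𝓘(ℝ, K) η x) (v : TangentSpace (𝓡 n) x) :
    tderiv n (fun y => (inner ℝ (ξ y) (η y) : ℝ)) x v =
      inner ℝ (ξ x) (tderiv n η x v) + inner ℝ (tderiv n ξ x v) (η x) := by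
  rw [tderiv_eq_fderiv hξ, tderiv_eq_fderiv hη, tderiv_eq_fderiv (mdifferentiableAt_inner hξ hη)]
  have h := fderiv_inner_apply ℝ (mdifferentiableAt_iff_chart.1 hξ).2
    (mdifferentiableAt_iff_chart.1 hη).2 v
  simp only [Function.comp_apply, extChartAt_to_inv] at h
  exact h

theorem inner_tderiv_of_const {c : ℝ} {U : Set M} (hU : IsOpen U) (hx : x ∈ U)
    (h : ∀ y ∈ U, inner ℝ (ξ y) (η y) = c)
    (hξ : MDifferentiableAt (𝓡 n) 𝓘(ℝ, K) ξ x)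
    (hη : MDifferentiableAt (𝓡 n) 𝓘(ℝ, K) η x) (v : TangentSpace (𝓡 n) x) :
    inner ℝ (tderiv n ξ x v) (η x) = -inner ℝ (ξ x) (tderiv n η x v) := by
  have h1 := tderiv_inner hξ hη v
  have h2 : (fun y => (inner ℝ (ξ y) (η y) : ℝ)) =ᶠ[nhds x] fun _ => c := by
    filter_upwards [hU.mem_nhds hx] with y hy using h y hy
  rw [tderiv_congr h2, tderiv_const] at h1
  have h3 : (0 : TangentSpace (𝓡 n) x →L[ℝ] ℝ) v = 0 := rfl
  rw [h3] at h1
  linarith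

theorem contMDiffOn_inner {U : Set M} (hξ : ContMDiffOn (𝓡 n) 𝓘(ℝ, K) ∞ ξ U)
    (hη : ContMDiffOn (𝓡 n) 𝓘(ℝ, K) ∞ η U) :
    ContMDiffOn (𝓡 n) 𝓘(ℝ, ℝ) ∞ (fun y => (inner ℝ (ξ y) (η y) : ℝ)) U := by
  have h : ContDiff ℝ ∞ (fun p : K × K => (inner ℝ p.1 p.2 : ℝ)) := contDiff_inner
  exact h.contMDiff.comp_contMDiffOn (hξ.prodMk_space hη)

end InnerRules

variable {U : Set M}

theorem isOpen_chart_preimage (hU : IsOpen U) (x : M) :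
    IsOpen ((extChartAt (𝓡 n) x).target ∩ (extChartAt (𝓡 n) x).symm ⁻¹' U) :=
  (continuousOn_extChartAt_symm x).isOpen_inter_preimage (isOpen_extChartAt_target x) hU

theorem mem_chart_preimage {x y : M} (hy : y ∈ (extChartAt (𝓡 n) x).source) (hU : y ∈ U) :
    extChartAt (𝓡 n) x y ∈
      (extChartAt (𝓡 n) x).target ∩ (extChartAt (𝓡 n) x).symm ⁻¹' U :=
  ⟨(extChartAt (𝓡 n) x).map_source hy, by
    simpa only [Set.mem_preimage, (extChartAt (𝓡 n) x).left_inv hy] using hU⟩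

theorem mdifferentiableAt_of_contMDiffOn {ξ : M → G} (hU : IsOpen U)
    (hξ : ContMDiffOn (𝓡 n) 𝓘(ℝ, G) ∞ ξ U) {x : M} (hx : x ∈ U) :
    MDifferentiableAt (𝓡 n) 𝓘(ℝ, G) ξ x :=
  (hξ.contMDiffAt (hU.mem_nhds hx)).mdifferentiableAt (by simp)

variable [IsManifold (𝓡 n) ∞ M]

/-- Chain rule through the chart at `x`. The tangent space at `y` is read through the preferred
chart at `y`, so the derivative of the chart at `x` enters as a change of coordinates. Derivatives
at all nearby points are thereby brought to one chart, where they can be differentiated again. -/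
theorem tderiv_apply_chart {ξ : M → G} (x : M) {y : M}
    (hy : y ∈ (extChartAt (𝓡 n) x).source)
    (h : MDifferentiableAt (𝓡 n) 𝓘(ℝ, G) ξ y) (v : TangentSpace (𝓡 n) y) :
    tderiv n ξ y v =
      fderiv ℝ (ξ ∘ (extChartAt (𝓡 n) x).symm) (extChartAt (𝓡 n) x y)
        (tderiv n (extChartAt (𝓡 n) x) y v) := by
  have : IsManifold (𝓡 n) 1 M := IsManifold.of_le (n := ∞) (by simp)
  have hy' : y ∈ (chartAt (EuclideanSpace ℝ (Fin n)) x).source := by simpa using hy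
  have hev : ξ =ᶠ[nhds y] (ξ ∘ (extChartAt (𝓡 n) x).symm) ∘ (extChartAt (𝓡 n) x) := by
    filter_upwards [extChartAt_source_mem_nhds' hy] with z hz
    simp only [Function.comp_apply, (extChartAt (𝓡 n) x).left_inv hz]
  have hs : MDifferentiableAt 𝓘(ℝ, EuclideanSpace ℝ (Fin n)) (𝓡 n) (extChartAt (𝓡 n) x).symm
      (extChartAt (𝓡 n) x y) := by
    have h1 := contMDiffOn_extChartAt_symm (I := 𝓡 n) (n := ∞) x
    have h2 := (h1.contMDiffAt (x := extChartAt (𝓡 n) x y) ?_).mdifferentiableAt (by simp)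
    · exact h2
    · exact extChartAt_target_mem_nhds' ((extChartAt (𝓡 n) x).map_source hy)
  have hc : MDifferentiableAt 𝓘(ℝ, EuclideanSpace ℝ (Fin n)) 𝓘(ℝ, G)
      (ξ ∘ (extChartAt (𝓡 n) x).symm) (extChartAt (𝓡 n) x y) := by
    refine MDifferentiableAt.comp _ ?_ hs
    rw [(extChartAt (𝓡 n) x).left_inv hy]
    exact h
  have h1 := mfderiv_comp_apply y hc (mdifferentiableAt_extChartAt hy') v
  rw [mfderiv_eq_fderiv] at h1
  rw [tderiv_congr hev]
  exact h1

/-- The space `T_xM` is by convention the model space seen through this very chart. -/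
theorem tderiv_extChartAt_self (x : M) (v : TangentSpace (𝓡 n) x) :
    tderiv n (extChartAt (𝓡 n) x) x v = v := by
  have : IsManifold (𝓡 n) 1 M := IsManifold.of_le (n := ∞) (by simp)
  rw [tderiv_eq_fderiv (mdifferentiableAt_extChartAt (mem_chart_source _ x))]
  have h : (extChartAt (𝓡 n) x) ∘ (extChartAt (𝓡 n) x).symm =ᶠ[nhds (extChartAt (𝓡 n) x x)] id := by
    filter_upwards [extChartAt_target_mem_nhds x] with z hz
    exact (extChartAt (𝓡 n) x).right_inv hz
  rw [h.fderiv_eq, fderiv_id]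
  rfl


theorem contDiffOn_comp_chart {ξ : M → G} (hξ : ContMDiffOn (𝓡 n) 𝓘(ℝ, G) ∞ ξ U) (x : M) :
    ContDiffOn ℝ ∞ (ξ ∘ (extChartAt (𝓡 n) x).symm)
      ((extChartAt (𝓡 n) x).target ∩ (extChartAt (𝓡 n) x).symm ⁻¹' U) := by
  rw [← contMDiffOn_iff_contDiffOn]
  exact hξ.comp ((contMDiffOn_extChartAt_symm x).mono Set.inter_subset_left) fun p hp => hp.2

/-- A vector field read in the preferred chart at `x`. -/
def chartField (x : M) (X : (y : M) → TangentSpace (𝓡 n) y) (p : EuclideanSpace ℝ (Fin n)) :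
    EuclideanSpace ℝ (Fin n) :=
  tderiv n (extChartAt (𝓡 n) x) ((extChartAt (𝓡 n) x).symm p) (X ((extChartAt (𝓡 n) x).symm p))

theorem chartField_self (x : M) (X : (y : M) → TangentSpace (𝓡 n) y) :
    chartField x X (extChartAt (𝓡 n) x x) = X x := by
  unfold chartField
  rw [extChartAt_to_inv, tderiv_extChartAt_self]

theorem tderiv_chartField {ξ : M → G} (hU : IsOpen U) (hξ : ContMDiffOn (𝓡 n) 𝓘(ℝ, G) ∞ ξ U)
    (X : (y : M) → TangentSpace (𝓡 n) y) (x : M) {p : EuclideanSpace ℝ (Fin n)}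
    (hp : p ∈ (extChartAt (𝓡 n) x).target ∩ (extChartAt (𝓡 n) x).symm ⁻¹' U) :
    tderiv n ξ ((extChartAt (𝓡 n) x).symm p) (X ((extChartAt (𝓡 n) x).symm p)) =
      fderiv ℝ (ξ ∘ (extChartAt (𝓡 n) x).symm) p (chartField x X p) := by
  rw [tderiv_apply_chart x ((extChartAt (𝓡 n) x).map_target hp.1)
    (mdifferentiableAt_of_contMDiffOn hU hξ hp.2), (extChartAt (𝓡 n) x).right_inv hp.1]
  rfl

/-- The derivative of `ξ` factors through the derivative of the chart. The latter is therefore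
injective, hence bijective by equality of dimensions, and injectivity passes to the other factor. -/
theorem fderiv_chart_injective {ξ : M → G} (hU : IsOpen U)
    (hξ : ContMDiffOn (𝓡 n) 𝓘(ℝ, G) ∞ ξ U) (x : M) {p : EuclideanSpace ℝ (Fin n)}
    (hp : p ∈ (extChartAt (𝓡 n) x).target ∩ (extChartAt (𝓡 n) x).symm ⁻¹' U)
    (hinj : Function.Injective (tderiv n ξ ((extChartAt (𝓡 n) x).symm p))) :
    Function.Injective (fderiv ℝ (ξ ∘ (extChartAt (𝓡 n) x).symm) p) := by
  have h1 : ∀ v, tderiv n ξ ((extChartAt (𝓡 n) x).symm p) v =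
      fderiv ℝ (ξ ∘ (extChartAt (𝓡 n) x).symm) p
        (tderiv n (extChartAt (𝓡 n) x) ((extChartAt (𝓡 n) x).symm p) v) := by
    intro v
    rw [tderiv_apply_chart x ((extChartAt (𝓡 n) x).map_target hp.1)
      (mdifferentiableAt_of_contMDiffOn hU hξ hp.2), (extChartAt (𝓡 n) x).right_inv hp.1]
  let T : EuclideanSpace ℝ (Fin n) →ₗ[ℝ] EuclideanSpace ℝ (Fin n) :=
    (tderiv n (extChartAt (𝓡 n) x) ((extChartAt (𝓡 n) x).symm p)).toLinearMap
  have hT : Function.Injective T := fun u v huv => hinj ((h1 u).trans ((congrArg _ huv).trans (h1 v).symm))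
  intro u v huv
  obtain ⟨u', rfl⟩ := LinearMap.surjective_of_injective hT u
  obtain ⟨v', rfl⟩ := LinearMap.surjective_of_injective hT v
  have h2 : u' = v' := hinj ((h1 u').trans (huv.trans (h1 v').symm))
  rw [h2]

variable [FiniteDimensional ℝ G]
  {G' : Type*} [NormedAddCommGroup G'] [NormedSpace ℝ G']

/-- The components of `X` in the chart solve a linear system whose operator is the injective
derivative of `f` and whose right-hand side `df(X)` is smooth. -/
theorem contDiffOn_chartField {f : M → G} (hU : IsOpen U)
    (hf : ContMDiffOn (𝓡 n) 𝓘(ℝ, G) ∞ f U)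
    (hinj : ∀ y ∈ U, Function.Injective (tderiv n f y))
    {X : (y : M) → TangentSpace (𝓡 n) y}
    (hX : ContMDiffOn (𝓡 n) 𝓘(ℝ, G) ∞ (fun y => tderiv n f y (X y)) U) (x : M) :
    ContDiffOn ℝ ∞ (chartField x X)
      ((extChartAt (𝓡 n) x).target ∩ (extChartAt (𝓡 n) x).symm ⁻¹' U) := by
  have h1 := contDiffOn_comp_chart hf x
  have h2 := contDiffOn_comp_chart hX x
  have h3 := h1.fderiv_of_isOpen (m := ∞) (isOpen_chart_preimage hU x) (by simp)
  intro p hp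
  exact contDiffWithinAt_of_clm_apply hp (h3 p hp) (h2 p hp)
    (fun q hq => (tderiv_chartField hU hf X x hq).symm)
    (fderiv_chart_injective hU hf x hp (hinj _ hp.2))

theorem contMDiffOn_tderiv {f : M → G} (hU : IsOpen U)
    (hf : ContMDiffOn (𝓡 n) 𝓘(ℝ, G) ∞ f U)
    (hinj : ∀ y ∈ U, Function.Injective (tderiv n f y))
    {X : (y : M) → TangentSpace (𝓡 n) y}
    (hX : ContMDiffOn (𝓡 n) 𝓘(ℝ, G) ∞ (fun y => tderiv n f y (X y)) U)
    {ξ : M → G'} (hξ : ContMDiffOn (𝓡 n) 𝓘(ℝ, G') ∞ ξ U) :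
    ContMDiffOn (𝓡 n) 𝓘(ℝ, G') ∞ (fun y => tderiv n ξ y (X y)) U := by
  intro x hx
  refine ContMDiffAt.contMDiffWithinAt ?_
  have h1 := contDiffOn_chartField hU hf hinj hX x
  have h2 := (contDiffOn_comp_chart hξ x).fderiv_of_isOpen (m := ∞)
    (isOpen_chart_preimage hU x) (by simp)
  have h3 := (h2.clm_apply h1).contDiffAt ((isOpen_chart_preimage hU x).mem_nhds
    (mem_chart_preimage (mem_extChartAt_source x) hx))
  refine (ContMDiffAt.comp x h3.contMDiffAt contMDiffAt_extChartAt).congr_of_eventuallyEq ?_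
  filter_upwards [extChartAt_source_mem_nhds (I := 𝓡 n) x, hU.mem_nhds hx] with y hy hyU
  have h4 := tderiv_chartField hU hξ X x (mem_chart_preimage hy hyU)
  rwa [(extChartAt (𝓡 n) x).left_inv hy] at h4

/-- Product rule in the chart. The term that differentiates the components of `Y` lies in the image
of `dξ`, so the normal projection kills it when `ξ` is the immersion; the other term is symmetric.
-/
theorem tderiv_tderiv {f : M → G} (hU : IsOpen U)
    (hf : ContMDiffOn (𝓡 n) 𝓘(ℝ, G) ∞ f U)
    (hinj : ∀ y ∈ U, Function.Injective (tderiv n f y))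
    {Y : (y : M) → TangentSpace (𝓡 n) y}
    (hY : ContMDiffOn (𝓡 n) 𝓘(ℝ, G) ∞ (fun y => tderiv n f y (Y y)) U)
    {ξ : M → G'} (hξ : ContMDiffOn (𝓡 n) 𝓘(ℝ, G') ∞ ξ U)
    {x : M} (hx : x ∈ U) (v : TangentSpace (𝓡 n) x) :
    tderiv n (fun y => tderiv n ξ y (Y y)) x v =
      fderiv ℝ (fderiv ℝ (ξ ∘ (extChartAt (𝓡 n) x).symm)) (extChartAt (𝓡 n) x x) v (Y x) +
      tderiv n ξ x (fderiv ℝ (chartField x Y) (extChartAt (𝓡 n) x x) v) := by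
  have hp := mem_chart_preimage (mem_extChartAt_source (I := 𝓡 n) x) hx
  have hV := isOpen_chart_preimage (n := n) hU x
  have h1 := ((contDiffOn_chartField hU hf hinj hY x).contDiffAt
    (hV.mem_nhds hp)).differentiableAt (by simp)
  have h2 := (((contDiffOn_comp_chart hξ x).fderiv_of_isOpen (m := ∞)
    hV (by simp)).contDiffAt (hV.mem_nhds hp)).differentiableAt (by simp)
  rw [tderiv_eq_fderiv (mdifferentiableAt_of_contMDiffOn hU
    (contMDiffOn_tderiv hU hf hinj hY hξ) hx),
    tderiv_eq_fderiv (mdifferentiableAt_of_contMDiffOn hU hξ hx)]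
  have h3 : (fun y => tderiv n ξ y (Y y)) ∘ (extChartAt (𝓡 n) x).symm =ᶠ[nhds (extChartAt (𝓡 n) x x)]
      fun p => fderiv ℝ (ξ ∘ (extChartAt (𝓡 n) x).symm) p (chartField x Y p) := by
    filter_upwards [hV.mem_nhds hp] with p hp
    exact tderiv_chartField hU hξ Y x hp
  rw [h3.fderiv_eq, fderiv_clm_apply h2 h1, ← chartField_self x Y]
  exact add_comm _ _

/-- The vector `b` is the Lie bracket, computed in the chart at `x`. The Hessians of `ξ` cancel by
symmetry, so one `b` serves every `ξ`; applied to `ξ = f` this will identify it. -/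
theorem exists_commutator {f : M → G} (hU : IsOpen U)
    (hf : ContMDiffOn (𝓡 n) 𝓘(ℝ, G) ∞ f U)
    (hinj : ∀ y ∈ U, Function.Injective (tderiv n f y))
    {X Y : (y : M) → TangentSpace (𝓡 n) y}
    (hX : ContMDiffOn (𝓡 n) 𝓘(ℝ, G) ∞ (fun y => tderiv n f y (X y)) U)
    (hY : ContMDiffOn (𝓡 n) 𝓘(ℝ, G) ∞ (fun y => tderiv n f y (Y y)) U)
    {x : M} (hx : x ∈ U) :
    ∃ b : TangentSpace (𝓡 n) x, ∀ ξ : M → G, ContMDiffOn (𝓡 n) 𝓘(ℝ, G) ∞ ξ U →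
      tderiv n (fun y => tderiv n ξ y (Y y)) x (X x)
        - tderiv n (fun y => tderiv n ξ y (X y)) x (Y x) = tderiv n ξ x b := by
  refine ⟨fderiv ℝ (chartField x Y) (extChartAt (𝓡 n) x x) (X x) -
    fderiv ℝ (chartField x X) (extChartAt (𝓡 n) x x) (Y x), fun ξ hξ => ?_⟩
  have hp := mem_chart_preimage (mem_extChartAt_source (I := 𝓡 n) x) hx
  have hV := isOpen_chart_preimage (n := n) hU x
  have h1 := ((contDiffOn_comp_chart hξ x).contDiffAt (hV.mem_nhds hp)).isSymmSndFDerivAt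
    (by rw [minSmoothness_of_isRCLikeNormedField]; exact WithTop.coe_le_coe.2 (le_top (a := (2 : ℕ∞))))
  rw [tderiv_tderiv hU hf hinj hX hξ hx, tderiv_tderiv hU hf hinj hY hξ hx]
  have h2 := h1 (X x) (Y x)
  have h3 : ∀ u v : EuclideanSpace ℝ (Fin n),
    tderiv n ξ x (u - v : EuclideanSpace ℝ (Fin n)) = tderiv n ξ x u - tderiv n ξ x v :=
    fun u v => map_sub (tderiv n ξ x) u v
  rw [h3]
  erw [h2]
  abel

end Chart

/-! ### Linear algebra at a point: projections and traces in an orthonormal frame -/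

section Pointwise

variable {n : ℕ} {M : Type*} [TopologicalSpace M] [ChartedSpace (EuclideanSpace ℝ (Fin n)) M]

/-- The coordinates of a tangent vector in the preferred chart. -/
def tcoord {x : M} (u : TangentSpace (𝓡 n) x) (m : Fin n) : ℝ :=
  WithLp.ofLp (p := 2) (V := Fin n → ℝ) u m

theorem sum_coordVec (x : M) (u : TangentSpace (𝓡 n) x) :
    ∑ m, tcoord u m • coordVec x m = u := by
  have h := (EuclideanSpace.basisFun (Fin n) ℝ).sum_repr (u : EuclideanSpace ℝ (Fin n))
  simp only [EuclideanSpace.basisFun_apply] at h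
  exact h

theorem exists_sum_smul_eq {e : Fin n → EuclideanSpace ℝ (Fin n)} (h : LinearIndependent ℝ e)
    (u : EuclideanSpace ℝ (Fin n)) : ∃ a : Fin n → ℝ, ∑ i, a i • e i = u := by
  have hu : u ∈ Submodule.span ℝ (Set.range e) := by
    rw [h.span_eq_top_of_card_eq_finrank' (by simp)]
    trivial
  exact (Submodule.mem_span_range_iff_exists_fun ℝ).1 hu

theorem tangentComp_eq_sum_coordVec (f : M → Amb n) (x : M) (v : Amb n) :
    tangentComp f x v = ∑ k, ∑ l,
      ((metric f x)⁻¹ k l * inner ℝ v (differential f x (coordVec x l))) • coordVec x k := rfl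

/-- `tangentComp` as a linear map. -/
def tangentCompL (f : M → Amb n) (x : M) : Amb n →ₗ[ℝ] TangentSpace (𝓡 n) x where
  toFun := tangentComp f x
  map_add' v w := by
    simp only [tangentComp_eq_sum_coordVec, inner_add_left, mul_add, add_smul,
      Finset.sum_add_distrib]
  map_smul' a v := by
    simp only [tangentComp_eq_sum_coordVec, real_inner_smul_left, Finset.smul_sum, smul_smul,
      RingHom.id_apply, mul_left_comm]

/-- `normalPart` as a linear map. -/
def normalPartL (f : M → Amb n) (x : M) : Amb n →ₗ[ℝ] Amb n :=
  LinearMap.id - (differential f x).toLinearMap ∘ₗ tangentCompL f x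

theorem normalPart_eq (f : M → Amb n) (x : M) (v : Amb n) :
    normalPart f x v = normalPartL f x v := rfl

/-- The second fundamental form as a bilinear map. -/
def secondFFL (f : M → Amb n) (x : M) :
    TangentSpace (𝓡 n) x →ₗ[ℝ] TangentSpace (𝓡 n) x →ₗ[ℝ] Amb n :=
  LinearMap.mk₂ ℝ (secondFF f x)
    (fun u u' v => by
      unfold secondFF
      rw [normalPart_eq, normalPart_eq, normalPart_eq, ← map_add]
      congr 1
      exact congrArg (fun L : EuclideanSpace ℝ (Fin n) →L[ℝ] Amb n => L v) (map_add (fderiv ℝ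
        (fderiv ℝ (f ∘ (extChartAt (𝓡 n) x).symm)) (extChartAt (𝓡 n) x x)) u u'))
    (fun a u v => by
      unfold secondFF
      rw [normalPart_eq, normalPart_eq, ← map_smul]
      congr 1
      exact congrArg (fun L : EuclideanSpace ℝ (Fin n) →L[ℝ] Amb n => L v) (map_smul (fderiv ℝ
        (fderiv ℝ (f ∘ (extChartAt (𝓡 n) x).symm)) (extChartAt (𝓡 n) x x)) a u))
    (fun u v v' => by
      unfold secondFF
      rw [normalPart_eq, normalPart_eq, normalPart_eq, ← map_add]
      congr 1
      exact map_add (fderiv ℝ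
        (fderiv ℝ (f ∘ (extChartAt (𝓡 n) x).symm)) (extChartAt (𝓡 n) x x) u) v v')
    (fun a u v => by
      unfold secondFF
      rw [normalPart_eq, normalPart_eq, ← map_smul]
      congr 1
      exact map_smul (fderiv ℝ
        (fderiv ℝ (f ∘ (extChartAt (𝓡 n) x).symm)) (extChartAt (𝓡 n) x x) u) a v)

theorem secondFF_eq (f : M → Amb n) (x : M) (u v : TangentSpace (𝓡 n) x) :
    secondFF f x u v = secondFFL f x u v := rfl

section TangentFrame

variable {f : M → Amb n} {x : M} {e : Fin n → TangentSpace (𝓡 n) x}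

/-- With `b` the matrix of components of the frame, orthonormality reads `b g bᵀ = 1`. Hence `(det
b)² det g = 1` and `g⁻¹ = bᵀ b`, which turns contractions with `g⁻¹` into sums over the frame. -/
theorem metric_mul_frame (he : Orthonormal ℝ fun i => differential f x (e i)) :
    (Matrix.of fun i m : Fin n => tcoord (e i) m) * metric f x *
      (Matrix.of fun i m : Fin n => tcoord (e i) m).transpose = 1 := by
  ext i j
  have h : inner ℝ (differential f x (e i)) (differential f x (e j)) = (1 : Matrix _ _ ℝ) i j := by
    rw [orthonormal_iff_ite.1 he i j, Matrix.one_apply]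
  have h2 : ∀ u w : TangentSpace (𝓡 n) x, inner ℝ (differential f x u) (differential f x w) =
      ∑ k, ∑ l, tcoord u k * tcoord w l * metric f x k l := by
    intro u w
    conv_lhs => rw [← sum_coordVec x u, ← sum_coordVec x w]
    simp only [map_sum, map_smul, sum_inner, inner_sum, real_inner_smul_left,
      real_inner_smul_right, metric, Matrix.of_apply]
    rw [Finset.sum_comm]
    refine Finset.sum_congr rfl fun k _ => Finset.sum_congr rfl fun l _ => ?_
    ring
  rw [← h, h2, Finset.sum_comm]
  simp only [Matrix.mul_apply, Matrix.of_apply, Matrix.transpose_apply, Finset.sum_mul]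
  refine Finset.sum_congr rfl fun k _ => Finset.sum_congr rfl fun l _ => ?_
  ring

theorem metric_det_pos (he : Orthonormal ℝ fun i => differential f x (e i)) :
    0 < (metric f x).det := by
  have h := congrArg Matrix.det (metric_mul_frame he)
  rw [Matrix.det_mul, Matrix.det_mul, Matrix.det_transpose, Matrix.det_one] at h
  set d := (Matrix.of fun i m : Fin n => tcoord (e i) m).det
  by_contra hc
  nlinarith [mul_nonneg (sq_nonneg d) (not_lt.1 hc |> neg_nonneg.2)]

theorem metric_inv_apply (he : Orthonormal ℝ fun i => differential f x (e i)) (k l : Fin n) :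
    (metric f x)⁻¹ k l =
      ∑ i, tcoord (e i) k * tcoord (e i) l := by
  have h := metric_mul_frame he
  set b := (Matrix.of fun i m : Fin n => tcoord (e i) m) with hb
  have h1 : metric f x * (b.transpose * b) = 1 := by
    rw [Matrix.mul_assoc, mul_eq_one_comm, Matrix.mul_assoc] at h
    exact h
  rw [Matrix.inv_eq_right_inv h1, Matrix.mul_apply]
  rfl

theorem tangentComp_eq (he : Orthonormal ℝ fun i => differential f x (e i)) (v : Amb n) :
    tangentComp f x v = ∑ i, (inner ℝ v (differential f x (e i)) : ℝ) • e i := by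
  have h : ∀ i, (inner ℝ v (differential f x (e i)) : ℝ) =
      ∑ l, tcoord (e i) l * inner ℝ v (differential f x (coordVec x l)) := by
    intro i
    conv_lhs => rw [← sum_coordVec x (e i)]
    simp only [map_sum, map_smul, inner_sum, real_inner_smul_right]
  have h2 : ∀ i, (inner ℝ v (differential f x (e i)) : ℝ) • e i =
      ∑ k, ∑ l, (tcoord (e i) k * tcoord (e i) l *
        inner ℝ v (differential f x (coordVec x l))) • coordVec x k := by
    intro i
    conv_lhs => rw [h i]; arg 2; rw [← sum_coordVec x (e i)]
    rw [Finset.smul_sum]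
    refine Finset.sum_congr rfl fun k _ => ?_
    rw [smul_smul, Finset.sum_mul, Finset.sum_smul]
    refine Finset.sum_congr rfl fun l _ => ?_
    congr 1
    ring
  rw [tangentComp_eq_sum_coordVec]
  symm
  rw [Finset.sum_congr rfl fun i _ => h2 i, Finset.sum_comm]
  refine Finset.sum_congr rfl fun k _ => ?_
  rw [Finset.sum_comm]
  refine Finset.sum_congr rfl fun l _ => ?_
  rw [metric_inv_apply he, Finset.sum_mul, Finset.sum_smul]

/-- The frame is independent because its image is, and `n` independent vectors span the
`n`-dimensional `T_xM`. -/
theorem sum_inner_frame (he : Orthonormal ℝ fun i => differential f x (e i))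
    (u : TangentSpace (𝓡 n) x) :
    ∑ i, (inner ℝ (differential f x u) (differential f x (e i)) : ℝ) • e i = u := by
  have hli := LinearIndependent.of_comp (differential f x).toLinearMap he.linearIndependent
  obtain ⟨a, ha⟩ := exists_sum_smul_eq hli u
  have ha' : ∑ i, a i • e i = u := ha
  rw [← ha']
  refine Finset.sum_congr rfl fun j _ => ?_
  congr 1
  rw [map_sum, sum_inner]
  simp only [map_smul, real_inner_smul_left, orthonormal_iff_ite.1 he]
  simp

theorem tangentComp_differential (he : Orthonormal ℝ fun i => differential f x (e i))
    (u : TangentSpace (𝓡 n) x) : tangentComp f x (differential f x u) = u := by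
  rw [tangentComp_eq he, sum_inner_frame he]

theorem differential_injective (he : Orthonormal ℝ fun i => differential f x (e i)) :
    Function.Injective (differential f x) := fun u v huv => by
  rw [← tangentComp_differential he u, huv, tangentComp_differential he]

theorem normalPart_differential (he : Orthonormal ℝ fun i => differential f x (e i))
    (u : TangentSpace (𝓡 n) x) : normalPart f x (differential f x u) = 0 := by
  rw [normalPart, tangentComp_differential he, sub_self]

theorem tangentComp_of_normal (he : Orthonormal ℝ fun i => differential f x (e i)) {v : Amb n}
    (hv : ∀ u, inner ℝ v (differential f x u) = 0) : tangentComp f x v = 0 := by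
  rw [tangentComp_eq he]
  exact Finset.sum_eq_zero fun i _ => by rw [hv, zero_smul]

theorem normalPart_of_normal (he : Orthonormal ℝ fun i => differential f x (e i)) {v : Amb n}
    (hv : ∀ u, inner ℝ v (differential f x u) = 0) : normalPart f x v = v := by
  rw [normalPart, tangentComp_of_normal he hv, map_zero, sub_zero]

theorem inner_normalPart_differential (he : Orthonormal ℝ fun i => differential f x (e i))
    (v : Amb n) (u : TangentSpace (𝓡 n) x) :
    inner ℝ (normalPart f x v) (differential f x u) = 0 := by
  rw [normalPart, inner_sub_left, tangentComp_eq he, sub_eq_zero]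
  conv_lhs => rw [← sum_inner_frame he u]
  simp only [map_sum, map_smul, inner_sum, sum_inner, real_inner_smul_left, real_inner_smul_right]
  refine Finset.sum_congr rfl fun i _ => ?_
  rw [real_inner_comm (differential f x u)]
  ring

theorem meanCurvature_eq (he : Orthonormal ℝ fun i => differential f x (e i)) :
    meanCurvature f x = ∑ k, secondFF f x (e k) (e k) := by
  have h : ∀ k, secondFF f x (e k) (e k) = ∑ i, ∑ j, (tcoord (e k) i *
      tcoord (e k) j) • secondFF f x (coordVec x i) (coordVec x j) := by
    intro k
    conv_lhs => rw [← sum_coordVec x (e k)]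
    simp only [secondFF_eq, map_sum, map_smul, LinearMap.sum_apply, LinearMap.smul_apply,
      Finset.smul_sum, smul_smul]
    rw [Finset.sum_comm]
    refine Finset.sum_congr rfl fun i _ => Finset.sum_congr rfl fun j _ => ?_
    rw [mul_comm]
  rw [meanCurvature]
  symm
  rw [Finset.sum_congr rfl fun k _ => h k, Finset.sum_comm]
  refine Finset.sum_congr rfl fun i _ => ?_
  rw [Finset.sum_comm]
  refine Finset.sum_congr rfl fun j _ => ?_
  rw [metric_inv_apply he, Finset.sum_smul]

end TangentFrame

section FullFrame

variable {f : M → Amb n} {x : M} {e : Fin n → TangentSpace (𝓡 n) x} {ν : Fin 2 → Amb n}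

theorem eq_sum_frame (he : Orthonormal ℝ fun i => differential f x (e i)) (hν : Orthonormal ℝ ν)
    (hn : ∀ α u, inner ℝ (ν α) (differential f x u) = 0) (v : Amb n) :
    v = ∑ i, (inner ℝ v (differential f x (e i)) : ℝ) • differential f x (e i) +
      ∑ α, (inner ℝ v (ν α) : ℝ) • ν α := by
  have ho : Orthonormal ℝ (Sum.elim (fun i => differential f x (e i)) ν) := by
    rw [orthonormal_iff_ite]
    rintro (i | α) (j | β)
    · simpa using orthonormal_iff_ite.1 he i j
    · simpa using (real_inner_comm _ _).trans (hn β (e i))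
    · simpa using hn α (e j)
    · simpa using orthonormal_iff_ite.1 hν α β
  have hs : ⊤ ≤ Submodule.span ℝ (Set.range (Sum.elim (fun i => differential f x (e i)) ν)) := by
    rw [ho.linearIndependent.span_eq_top_of_card_eq_finrank' (by simp)]
  have h := (OrthonormalBasis.mk ho hs).sum_repr' v
  rw [Fintype.sum_sum_type] at h
  simp only [OrthonormalBasis.coe_mk, Sum.elim_inl, Sum.elim_inr] at h
  conv_lhs => rw [← h]
  simp only [real_inner_comm v]

theorem normalPart_eq_sum (he : Orthonormal ℝ fun i => differential f x (e i))
    (hν : Orthonormal ℝ ν) (hn : ∀ α u, inner ℝ (ν α) (differential f x u) = 0) (v : Amb n) :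
    normalPart f x v = ∑ α, (inner ℝ v (ν α) : ℝ) • ν α := by
  rw [normalPart, tangentComp_eq he, map_sum, sub_eq_iff_eq_add']
  simp only [map_smul]
  exact eq_sum_frame he hν hn v

theorem inner_normalPart (hn : ∀ α u, inner ℝ (ν α) (differential f x u) = 0) (v : Amb n)
    (α : Fin 2) : inner ℝ (normalPart f x v) (ν α) = inner ℝ v (ν α) := by
  rw [normalPart, inner_sub_left, real_inner_comm (ν α) (differential f x _), hn, sub_zero]

end FullFrame

/-! ### The rotation of the normal plane as a determinant -/

section Rotation

/-- The determinant of `n + 2` vectors of `ℝ^{n+2}`. -/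
def ambDet (n : ℕ) : (Amb n) [⋀^Fin (n + 2)]→ₗ[ℝ] ℝ :=
  Matrix.detRowAlternating.compLinearMap (WithLp.linearEquiv 2 ℝ (Fin (n + 2) → ℝ)).toLinearMap

theorem ambDet_apply (r : Fin (n + 2) → Amb n) :
    ambDet n r = Matrix.det (Matrix.of fun i j : Fin (n + 2) => r i j) := rfl

/-- The family `a_1, …, a_n, v, w`. -/
def snoc2 (a : Fin n → Amb n) (v w : Amb n) : Fin (n + 2) → Amb n :=
  Fin.snoc (Fin.snoc a v : Fin (n + 1) → Amb n) w

variable (a : Fin n → Amb n) (v w : Amb n)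

theorem snoc2_last : snoc2 a v w (Fin.last (n + 1)) = w := by simp [snoc2]

theorem snoc2_penultimate : snoc2 a v w (Fin.last n).castSucc = v := by simp [snoc2]

theorem snoc2_castSucc (i : Fin n) : snoc2 a v w i.castSucc.castSucc = a i := by simp [snoc2]

theorem snoc2_eq_update_last : snoc2 a v w = Function.update (snoc2 a v 0) (Fin.last (n + 1)) w :=
  (Fin.update_snoc_last (α := fun _ => Amb n) _ _ _).symm

theorem snoc2_eq_update_penultimate :
    snoc2 a v w = Function.update (snoc2 a 0 w) (Fin.last n).castSucc v := by
  simp only [snoc2, ← Fin.snoc_update, Fin.update_snoc_last]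

theorem ambDet_snoc2_self : ambDet n (snoc2 a v v) = 0 :=
  (ambDet n).map_eq_zero_of_eq _ (i := Fin.last (n + 1)) (j := (Fin.last n).castSucc)
    (by rw [snoc2_last, snoc2_penultimate]) (Fin.castSucc_lt_last _).ne'

theorem ambDet_snoc2_right (i : Fin n) : ambDet n (snoc2 a v (a i)) = 0 :=
  (ambDet n).map_eq_zero_of_eq _ (i := Fin.last (n + 1)) (j := i.castSucc.castSucc)
    (by rw [snoc2_last, snoc2_castSucc]) (Fin.castSucc_lt_last _).ne'

theorem ambDet_snoc2_add_left (v' : Amb n) :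
    ambDet n (snoc2 a (v + v') w) = ambDet n (snoc2 a v w) + ambDet n (snoc2 a v' w) := by
  rw [snoc2_eq_update_penultimate a (v + v'), snoc2_eq_update_penultimate a v,
    snoc2_eq_update_penultimate a v', AlternatingMap.map_update_add]

theorem ambDet_snoc2_smul_left (c : ℝ) :
    ambDet n (snoc2 a (c • v) w) = c * ambDet n (snoc2 a v w) := by
  rw [snoc2_eq_update_penultimate a (c • v), snoc2_eq_update_penultimate a v,
    AlternatingMap.map_update_smul, smul_eq_mul]

theorem ambDet_snoc2_add_right (w' : Amb n) :
    ambDet n (snoc2 a v (w + w')) = ambDet n (snoc2 a v w) + ambDet n (snoc2 a v w') := by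
  rw [snoc2_eq_update_last a v (w + w'), snoc2_eq_update_last a v w,
    snoc2_eq_update_last a v w', AlternatingMap.map_update_add]

theorem ambDet_snoc2_smul_right (c : ℝ) :
    ambDet n (snoc2 a v (c • w)) = c * ambDet n (snoc2 a v w) := by
  rw [snoc2_eq_update_last a v (c • w), snoc2_eq_update_last a v w,
    AlternatingMap.map_update_smul, smul_eq_mul]

theorem ambDet_snoc2_swap : ambDet n (snoc2 a w v) = -ambDet n (snoc2 a v w) := by
  have h := ambDet_snoc2_self a (v + w)
  rw [ambDet_snoc2_add_left, ambDet_snoc2_add_right, ambDet_snoc2_add_right, ambDet_snoc2_self,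
    ambDet_snoc2_self] at h
  linarith

/-- `w ↦ det(a_1, …, a_n, v, w)` as a linear form. -/
def ambDetRight : Amb n →ₗ[ℝ] ℝ where
  toFun w := ambDet n (snoc2 a v w)
  map_add' w w' := ambDet_snoc2_add_right a v w w'
  map_smul' c w := ambDet_snoc2_smul_right a v w c

/-- The square of `det R` is the determinant of the Gram matrix `R Rᵀ`, which is block diagonal with
an identity block for `v, w`. -/
theorem ambDet_snoc2_sq (hv : Orthonormal ℝ ![v, w]) (hva : ∀ i, inner ℝ v (a i) = 0)
    (hwa : ∀ i, inner ℝ w (a i) = 0) : ambDet n (snoc2 a v w) ^ 2 =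
      (Matrix.of fun i j : Fin n => (inner ℝ (a i) (a j) : ℝ)).det := by
  set R : Matrix (Fin (n + 2)) (Fin (n + 2)) ℝ := Matrix.of fun i j => snoc2 a v w i j with hR
  have h1 : ambDet n (snoc2 a v w) ^ 2 = (R * R.transpose).det := by
    rw [Matrix.det_mul, Matrix.det_transpose, sq, ambDet_apply]
  have h2 : ∀ r c, (R * R.transpose) r c = inner ℝ (snoc2 a v w r) (snoc2 a v w c) := by
    intro r c
    rw [Matrix.mul_apply, PiLp.inner_apply]
    refine Finset.sum_congr rfl fun k _ => ?_
    simp [hR, mul_comm]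
  have hl : ∀ i : Fin n, (finSumFinEquiv (Sum.inl i) : Fin (n + 2)) = i.castSucc.castSucc :=
    fun i => rfl
  have hr0 : (finSumFinEquiv (Sum.inr (0 : Fin 2)) : Fin (n + 2)) = (Fin.last n).castSucc := rfl
  have hr1 : (finSumFinEquiv (Sum.inr (1 : Fin 2)) : Fin (n + 2)) = Fin.last (n + 1) := rfl
  have hv' := orthonormal_iff_ite.1 hv
  have hva' : ∀ i, inner ℝ (a i) v = 0 := fun i => (real_inner_comm _ _).trans (hva i)
  have hwa' : ∀ i, inner ℝ (a i) w = 0 := fun i => (real_inner_comm _ _).trans (hwa i)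
  have h3 : (R * R.transpose).submatrix (finSumFinEquiv (m := n) (n := 2)) finSumFinEquiv =
      Matrix.fromBlocks (Matrix.of fun i j : Fin n => (inner ℝ (a i) (a j) : ℝ)) 0 0 1 := by
    ext (i | α) (j | β)
    · rw [Matrix.submatrix_apply, h2, hl, hl, snoc2_castSucc, snoc2_castSucc]
      rfl
    · fin_cases β
      · simp [h2, hl, hr0, snoc2_castSucc, snoc2_penultimate, hva']
      · simp [h2, hl, hr1, snoc2_castSucc, snoc2_last, hwa']
    · fin_cases α
      · simp [h2, hl, hr0, snoc2_castSucc, snoc2_penultimate, hva]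
      · simp [h2, hl, hr1, snoc2_castSucc, snoc2_last, hwa]
    · rw [Matrix.submatrix_apply, h2, Matrix.fromBlocks_apply₂₂, Matrix.one_apply, ← hv' α β]
      fin_cases α <;> fin_cases β <;> simp [hr0, hr1, snoc2_last, snoc2_penultimate]
  rw [h1, ← Matrix.det_submatrix_equiv_self (finSumFinEquiv (m := n) (n := 2)), h3,
    Matrix.det_fromBlocks_zero₂₁, Matrix.det_one, mul_one]

variable {v w} {f : M → Amb n} {x : M}

/-- The components of `rotJ` prescribe this formula on the standard basis; linearity of the
determinant in its last slot extends it to every `w`. -/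
theorem inner_rotJ (v w : Amb n) : inner ℝ (rotJ f x v) w =
    (Real.sqrt (metric f x).det)⁻¹ *
      ambDet n (snoc2 (fun i => differential f x (coordVec x i)) v w) := by
  have h1 : w = ∑ b, w b • (EuclideanSpace.single b (1 : ℝ) : Amb n) := by
    have h := (EuclideanSpace.basisFun (Fin (n + 2)) ℝ).sum_repr w
    simp only [EuclideanSpace.basisFun_apply] at h
    exact h.symm
  have h2 := congrArg (ambDetRight (fun i => differential f x (coordVec x i)) v) h1
  rw [map_sum] at h2
  have h3 : ambDet n (snoc2 (fun i => differential f x (coordVec x i)) v w) = _ := h2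
  rw [h3, Finset.mul_sum, PiLp.inner_apply]
  refine Finset.sum_congr rfl fun b _ => ?_
  rw [map_smul, smul_eq_mul]
  have h4 : rotJ f x v b = (Real.sqrt (metric f x).det)⁻¹ *
    ambDetRight (fun i => differential f x (coordVec x i)) v (EuclideanSpace.single b 1) := rfl
  rw [h4]
  simp only [RCLike.inner_apply, conj_trivial]
  ring

theorem rotJ_add (v v' : Amb n) : rotJ f x (v + v') = rotJ f x v + rotJ f x v' := by
  refine ext_inner_right ℝ fun w => ?_
  rw [inner_add_left, inner_rotJ, inner_rotJ, inner_rotJ, ambDet_snoc2_add_left, mul_add]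

theorem rotJ_smul (c : ℝ) (v : Amb n) : rotJ f x (c • v) = c • rotJ f x v := by
  refine ext_inner_right ℝ fun w => ?_
  rw [real_inner_smul_left, inner_rotJ, inner_rotJ, ambDet_snoc2_smul_left]
  ring

theorem inner_rotJ_self (v : Amb n) : inner ℝ (rotJ f x v) v = 0 := by
  rw [inner_rotJ, ambDet_snoc2_self, mul_zero]

theorem inner_rotJ_swap (v w : Amb n) : inner ℝ (rotJ f x w) v = -inner ℝ (rotJ f x v) w := by
  rw [inner_rotJ, inner_rotJ, ambDet_snoc2_swap, mul_neg]

theorem inner_rotJ_differential (v : Amb n) (u : TangentSpace (𝓡 n) x) :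
    inner ℝ (rotJ f x v) (differential f x u) = 0 := by
  rw [← sum_coordVec x u, map_sum, inner_sum]
  refine Finset.sum_eq_zero fun i _ => ?_
  rw [map_smul, real_inner_smul_right, inner_rotJ,
    ambDet_snoc2_right (fun i => differential f x (coordVec x i)), mul_zero, mul_zero]

variable {e : Fin n → TangentSpace (𝓡 n) x} {ν : Fin 2 → Amb n}

/-- The Gram determinant of `ambDet_snoc2_sq` is here `det g`, which the factor in `rotJ` cancels.
The sign cannot be decided at a point. -/
theorem inner_rotJ_sq (he : Orthonormal ℝ fun i => differential f x (e i)) (hν : Orthonormal ℝ ν)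
    (hn : ∀ α u, inner ℝ (ν α) (differential f x u) = 0) :
    (inner ℝ (rotJ f x (ν 0)) (ν 1) : ℝ) ^ 2 = 1 := by
  have h := ambDet_snoc2_sq (fun i => differential f x (coordVec x i)) (ν 0) (ν 1)
    (by convert hν using 1; ext i : 1; fin_cases i <;> rfl) (fun i => hn 0 _) (fun i => hn 1 _)
  have h2 : (Matrix.of fun i j : Fin n => (inner ℝ (differential f x (coordVec x i))
    (differential f x (coordVec x j)) : ℝ)).det = (metric f x).det := rfl
  rw [inner_rotJ, mul_pow, h, h2, inv_pow, Real.sq_sqrt (metric_det_pos he).le,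
    inv_mul_cancel₀ (metric_det_pos he).ne']

theorem rotJ_zero_eq (he : Orthonormal ℝ fun i => differential f x (e i)) (hν : Orthonormal ℝ ν)
    (hn : ∀ α u, inner ℝ (ν α) (differential f x u) = 0) :
    rotJ f x (ν 0) = (inner ℝ (rotJ f x (ν 0)) (ν 1) : ℝ) • ν 1 := by
  conv_lhs => rw [eq_sum_frame he hν hn (rotJ f x (ν 0))]
  simp [inner_rotJ_differential, inner_rotJ_self]

theorem rotJ_one_eq (he : Orthonormal ℝ fun i => differential f x (e i)) (hν : Orthonormal ℝ ν)
    (hn : ∀ α u, inner ℝ (ν α) (differential f x u) = 0) :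
    rotJ f x (ν 1) = -((inner ℝ (rotJ f x (ν 0)) (ν 1) : ℝ) • ν 0) := by
  conv_lhs => rw [eq_sum_frame he hν hn (rotJ f x (ν 1))]
  simp [inner_rotJ_differential, inner_rotJ_self, inner_rotJ_swap (ν 0) (ν 1)]

end Rotation

end Pointwise

/-! ### Fundamental equations of a framed immersion and Simons' identity -/

section StaticGeometry

variable {n : ℕ} {M : Type*} [TopologicalSpace M] [ChartedSpace (EuclideanSpace ℝ (Fin n)) M]

/-- An immersion with smooth orthonormal frames of its tangent and normal bundles over `U`. -/
structure IsFramed (U : Set M) (f : M → Amb n) (e : Fin n → (x : M) → TangentSpace (𝓡 n) x)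
    (ν : Fin 2 → M → Amb n) : Prop where
  isOpen : IsOpen U
  smooth : ContMDiffOn (𝓡 n) 𝓘(ℝ, Amb n) ∞ f U
  smooth_tangent : ∀ i, ContMDiffOn (𝓡 n) 𝓘(ℝ, Amb n) ∞ (fun y => differential f y (e i y)) U
  smooth_normal : ∀ α, ContMDiffOn (𝓡 n) 𝓘(ℝ, Amb n) ∞ (ν α) U
  orthonormal_tangent : ∀ y ∈ U, Orthonormal ℝ fun i => differential f y (e i y)
  orthonormal_normal : ∀ y ∈ U, Orthonormal ℝ fun α => ν α y
  normal : ∀ y ∈ U, ∀ α, ∀ w, inner ℝ (ν α y) (differential f y w) = 0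

/-- A vector field is smooth when its image under the differential of the immersion is. -/
def SmoothField (f : M → Amb n) (U : Set M) (X : (y : M) → TangentSpace (𝓡 n) y) : Prop :=
  ContMDiffOn (𝓡 n) 𝓘(ℝ, Amb n) ∞ (fun y => differential f y (X y)) U

/-- The tangential part of the derivative of an `ℝ^{n+2}`-valued function. -/
def tangentConn (f : M → Amb n) (X : (y : M) → TangentSpace (𝓡 n) y) (ξ : M → Amb n) (x : M) :
    TangentSpace (𝓡 n) x :=
  tangentComp f x (dirDeriv X ξ x)

theorem dirDeriv_eq (X : (y : M) → TangentSpace (𝓡 n) y) (ξ : M → Amb n) (x : M) :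
    dirDeriv X ξ x = tderiv n ξ x (X x) := rfl

theorem dirDeriv_eq_add (f : M → Amb n) (X : (y : M) → TangentSpace (𝓡 n) y) (ξ : M → Amb n)
    (x : M) : dirDeriv X ξ x = differential f x (tangentConn f X ξ x) + normalConn f X ξ x := by
  rw [normalConn, normalPart, tangentConn, add_sub_cancel]

theorem tangentComp_eq_map (f : M → Amb n) (x : M) (v : Amb n) :
    tangentComp f x v = tangentCompL f x v := rfl

theorem dirDeriv_congr {X : (y : M) → TangentSpace (𝓡 n) y} {ξ η : M → Amb n} {U : Set M}
    (hU : IsOpen U) (h : ∀ y ∈ U, ξ y = η y) {x : M} (hx : x ∈ U) :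
    dirDeriv X ξ x = dirDeriv X η x := by
  have h1 : ξ =ᶠ[nhds x] η := by filter_upwards [hU.mem_nhds hx] with y hy using h y hy
  rw [dirDeriv_eq, dirDeriv_eq, tderiv_congr h1]

variable {U : Set M} {f : M → Amb n} {e : Fin n → (x : M) → TangentSpace (𝓡 n) x}
  {ν : Fin 2 → M → Amb n}

theorem IsFramed.injective (hF : IsFramed U f e ν) :
    ∀ y ∈ U, Function.Injective (tderiv n f y) :=
  fun y hy => differential_injective (hF.orthonormal_tangent y hy)

theorem IsFramed.mdiff (hF : IsFramed U f e ν) {ξ : M → Amb n}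
    (hξ : ContMDiffOn (𝓡 n) 𝓘(ℝ, Amb n) ∞ ξ U) {x : M} (hx : x ∈ U) :
    MDifferentiableAt (𝓡 n) 𝓘(ℝ, Amb n) ξ x :=
  mdifferentiableAt_of_contMDiffOn hF.isOpen hξ hx

theorem IsFramed.smooth_normalPart (hF : IsFramed U f e ν) {ξ : M → Amb n}
    (hξ : ContMDiffOn (𝓡 n) 𝓘(ℝ, Amb n) ∞ ξ U) :
    ContMDiffOn (𝓡 n) 𝓘(ℝ, Amb n) ∞ (fun y => normalPart f y (ξ y)) U := by
  have h : ContMDiffOn (𝓡 n) 𝓘(ℝ, Amb n) ∞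
      (fun y => (inner ℝ (ξ y) (ν 0 y) : ℝ) • ν 0 y + (inner ℝ (ξ y) (ν 1 y) : ℝ) • ν 1 y) U :=
    ((contMDiffOn_inner hξ (hF.smooth_normal 0)).smul (hF.smooth_normal 0)).add
      ((contMDiffOn_inner hξ (hF.smooth_normal 1)).smul (hF.smooth_normal 1))
  refine h.congr fun y hy => ?_
  rw [normalPart_eq_sum (hF.orthonormal_tangent y hy) (hF.orthonormal_normal y hy)
    (hF.normal y hy), Fin.sum_univ_two]

theorem IsFramed.smooth_tangentComp (hF : IsFramed U f e ν) {ξ : M → Amb n}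
    (hξ : ContMDiffOn (𝓡 n) 𝓘(ℝ, Amb n) ∞ ξ U) :
    SmoothField f U (fun y => tangentComp f y (ξ y)) := by
  refine (hξ.sub (hF.smooth_normalPart hξ)).congr fun y _ => ?_
  simp [normalPart]

theorem IsFramed.inner_normalPart_eq_zero (hF : IsFramed U f e ν) {x : M} (hx : x ∈ U) (v : Amb n)
    (u : TangentSpace (𝓡 n) x) : inner ℝ (normalPart f x v) (differential f x u) = 0 :=
  inner_normalPart_differential (hF.orthonormal_tangent x hx) v u

variable {W X Y Z : (y : M) → TangentSpace (𝓡 n) y} {ξ η : M → Amb n} {x : M}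

theorem IsFramed.normalConn_congr (hF : IsFramed U f e ν) (h : ∀ y ∈ U, ξ y = η y) (hx : x ∈ U) :
    normalConn f X ξ x = normalConn f X η x := by
  rw [normalConn, normalConn, dirDeriv_congr hF.isOpen h hx]

theorem IsFramed.tangentConn_congr (hF : IsFramed U f e ν) (h : ∀ y ∈ U, ξ y = η y) (hx : x ∈ U) :
    tangentConn f X ξ x = tangentConn f X η x := by
  rw [tangentConn, tangentConn, dirDeriv_congr hF.isOpen h hx]

theorem IsFramed.normalConn_sub (hF : IsFramed U f e ν)
    (hξ : ContMDiffOn (𝓡 n) 𝓘(ℝ, Amb n) ∞ ξ U) (hη : ContMDiffOn (𝓡 n) 𝓘(ℝ, Amb n) ∞ η U)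
    (hx : x ∈ U) :
    normalConn f X (fun y => ξ y - η y) x = normalConn f X ξ x - normalConn f X η x := by
  rw [normalConn, dirDeriv_eq, tderiv_sub (hF.mdiff hξ hx) (hF.mdiff hη hx)]
  exact map_sub (normalPartL f x) _ _

theorem IsFramed.normalConn_sum (hF : IsFramed U f e ν) {ι : Type*} [Fintype ι] {ζ : ι → M → Amb n}
    (hζ : ∀ k, ContMDiffOn (𝓡 n) 𝓘(ℝ, Amb n) ∞ (ζ k) U) (hx : x ∈ U) :
    normalConn f X (fun y => ∑ k, ζ k y) x = ∑ k, normalConn f X (ζ k) x := by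
  rw [normalConn, dirDeriv_eq, tderiv_sum fun k => hF.mdiff (hζ k) hx]
  rw [sum_apply]
  exact map_sum (normalPartL f x) _ _

/-- The tangential part of the derivative of a normal field (Weingarten). -/
theorem IsFramed.tangentConn_eq (hF : IsFramed U f e ν)
    (hξ : ContMDiffOn (𝓡 n) 𝓘(ℝ, Amb n) ∞ ξ U)
    (hn : ∀ y ∈ U, ∀ u, inner ℝ (ξ y) (differential f y u) = 0) (hx : x ∈ U) :
    tangentConn f X ξ x =
      -∑ m, (inner ℝ (ξ x) (dirDeriv X (fun y => differential f y (e m y)) x) : ℝ) • e m x := by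
  rw [tangentConn, tangentComp_eq (hF.orthonormal_tangent x hx), ← Finset.sum_neg_distrib]
  refine Finset.sum_congr rfl fun m _ => ?_
  have h := inner_tderiv_of_const hF.isOpen hx (fun y hy => hn y hy (e m y)) (hF.mdiff hξ hx)
    (hF.mdiff (hF.smooth_tangent m) hx) (X x)
  rw [← dirDeriv_eq, ← dirDeriv_eq] at h
  rw [h, neg_smul]

/-- A symmetric family is annihilated by the skew connection form of an orthonormal frame. -/
theorem IsFramed.sum_connection_smul (hF : IsFramed U f e ν) (hx : x ∈ U)
    {B : Fin n → Fin n → Amb n} (hB : ∀ k m, B k m = B m k) :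
    ∑ k, ∑ m, (inner ℝ (dirDeriv X (fun y => differential f y (e k y)) x)
      (differential f x (e m x)) : ℝ) • B m k = 0 := by
  have h : ∀ k m, (inner ℝ (dirDeriv X (fun y => differential f y (e k y)) x)
      (differential f x (e m x)) : ℝ) = -inner ℝ (dirDeriv X (fun y => differential f y (e m y)) x)
      (differential f x (e k x)) := by
    intro k m
    have h1 := inner_tderiv_of_const (c := if k = m then 1 else 0) hF.isOpen hx
      (fun y hy => orthonormal_iff_ite.1 (hF.orthonormal_tangent y hy) k m)
      (hF.mdiff (hF.smooth_tangent k) hx) (hF.mdiff (hF.smooth_tangent m) hx) (X x)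
    rw [← dirDeriv_eq, ← dirDeriv_eq] at h1
    rw [h1, real_inner_comm]
  set S := ∑ k, ∑ m, (inner ℝ (dirDeriv X (fun y => differential f y (e k y)) x)
      (differential f x (e m x)) : ℝ) • B m k with hS
  -- Exchanging the summation indices changes the sign of the connection form and leaves `B` as it
  -- is.
  have hneg : S = -S := by
    rw [hS, ← Finset.sum_neg_distrib]
    conv_lhs => rw [Finset.sum_comm]
    refine Finset.sum_congr rfl fun k _ => ?_
    rw [← Finset.sum_neg_distrib]
    refine Finset.sum_congr rfl fun m _ => ?_
    rw [h m k, hB, neg_smul]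
  linear_combination (norm := module) (1 / 2 : ℝ) • hneg

theorem IsFramed.leviCivita_frame (hF : IsFramed U f e ν) (k : Fin n) (hx : x ∈ U) :
    leviCivita f X (e k) x = ∑ m, (inner ℝ (dirDeriv X (fun y => differential f y (e k y)) x)
      (differential f x (e m x)) : ℝ) • e m x :=
  tangentComp_eq (hF.orthonormal_tangent x hx) _

/-- `∇A` is a linear function of its first argument at the point. -/
theorem nablaA_sum_left {ι : Type*} [Fintype ι] (a : ι → ℝ)
    (V : ι → (y : M) → TangentSpace (𝓡 n) y) (hZ : Z x = ∑ m, a m • V m x) :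
    nablaA f Z X Y x = ∑ m, a m • nablaA f (V m) X Y x := by
  simp only [nablaA, normalConn, leviCivita, dirDeriv, hZ, secondFF_eq, normalPart_eq,
    tangentComp_eq_map, map_sum, map_smul, LinearMap.sum_apply, LinearMap.smul_apply,
    Finset.sum_sub_distrib, smul_sub]

variable [IsManifold (𝓡 n) ∞ M]

theorem IsFramed.smooth_dirDeriv (hF : IsFramed U f e ν) (hX : SmoothField f U X)
    (hξ : ContMDiffOn (𝓡 n) 𝓘(ℝ, Amb n) ∞ ξ U) :
    ContMDiffOn (𝓡 n) 𝓘(ℝ, Amb n) ∞ (dirDeriv X ξ) U :=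
  contMDiffOn_tderiv hF.isOpen hF.smooth hF.injective hX hξ

theorem IsFramed.smooth_normalConn (hF : IsFramed U f e ν) (hX : SmoothField f U X)
    (hξ : ContMDiffOn (𝓡 n) 𝓘(ℝ, Amb n) ∞ ξ U) :
    ContMDiffOn (𝓡 n) 𝓘(ℝ, Amb n) ∞ (normalConn f X ξ) U :=
  hF.smooth_normalPart (hF.smooth_dirDeriv hX hξ)

theorem IsFramed.smooth_tangentConn (hF : IsFramed U f e ν) (hX : SmoothField f U X)
    (hξ : ContMDiffOn (𝓡 n) 𝓘(ℝ, Amb n) ∞ ξ U) : SmoothField f U (tangentConn f X ξ) :=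
  hF.smooth_tangentComp (hF.smooth_dirDeriv hX hξ)

theorem IsFramed.smooth_leviCivita (hF : IsFramed U f e ν) (hX : SmoothField f U X)
    (hY : SmoothField f U Y) : SmoothField f U (leviCivita f X Y) :=
  hF.smooth_tangentConn hX hY

/-- Gauss's formula: `D_X(df Y)` is the Hessian of `f` in the chart plus a tangent vector, by
`tderiv_tderiv`. It replaces the definition of `A`, tied to the chart at each point, by an
expression that can be differentiated along `M`. -/
theorem IsFramed.secondFF_eq_normalConn (hF : IsFramed U f e ν) (hY : SmoothField f U Y)
    (hx : x ∈ U) : secondFF f x (X x) (Y x) =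
      normalConn f X (fun y => differential f y (Y y)) x := by
  have h := tderiv_tderiv hF.isOpen hF.smooth hF.injective hY hF.smooth hx (X x)
  have h1 : dirDeriv X (fun y => differential f y (Y y)) x = _ := h
  have h2 := normalPart_differential (hF.orthonormal_tangent x hx)
    (fderiv ℝ (chartField x Y) (extChartAt (𝓡 n) x x) (X x))
  rw [normalPart_eq] at h2
  rw [normalConn, h1, normalPart_eq, map_add]
  erw [h2]
  rw [add_zero]
  rfl

theorem IsFramed.secondFF_symm (hF : IsFramed U f e ν) (hx : x ∈ U) (u v : TangentSpace (𝓡 n) x) :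
    secondFF f x u v = secondFF f x v u := by
  have h := ((contDiffOn_comp_chart hF.smooth x).contDiffAt
    ((isOpen_chart_preimage hF.isOpen x).mem_nhds
      (mem_chart_preimage (mem_extChartAt_source x) hx))).isSymmSndFDerivAt
    (by rw [minSmoothness_of_isRCLikeNormedField]
        exact WithTop.coe_le_coe.2 (le_top (a := (2 : ℕ∞))))
  exact congrArg (normalPart f x) (h u v)

theorem IsFramed.smooth_secondFF (hF : IsFramed U f e ν) (hX : SmoothField f U X)
    (hY : SmoothField f U Y) :
    ContMDiffOn (𝓡 n) 𝓘(ℝ, Amb n) ∞ (fun y => secondFF f y (X y) (Y y)) U :=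
  (hF.smooth_normalConn hX hY).congr fun _ hy => hF.secondFF_eq_normalConn hY hy

/-- Flatness of the ambient space and vanishing torsion together: the bracket of
`exists_commutator`, tested on `ξ = f` and projected, is `∇_X Y - ∇_Y X`. -/
theorem IsFramed.dirDeriv_commutator (hF : IsFramed U f e ν) (hX : SmoothField f U X)
    (hY : SmoothField f U Y) (hξ : ContMDiffOn (𝓡 n) 𝓘(ℝ, Amb n) ∞ ξ U) (hx : x ∈ U) :
    dirDeriv X (dirDeriv Y ξ) x - dirDeriv Y (dirDeriv X ξ) x =
      dirDeriv (leviCivita f X Y) ξ x - dirDeriv (leviCivita f Y X) ξ x := by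
  obtain ⟨b, hb⟩ := exists_commutator hF.isOpen hF.smooth hF.injective hX hY hx
  have h1 : dirDeriv X (fun y => differential f y (Y y)) x -
    dirDeriv Y (fun y => differential f y (X y)) x = differential f x b := hb f hF.smooth
  have h2 : b = leviCivita f X Y x - leviCivita f Y X x := by
    rw [← tangentComp_differential (hF.orthonormal_tangent x hx) b, ← h1]
    exact map_sub (tangentCompL f x) _ _
  refine (hb ξ hξ).trans ?_
  rw [h2, map_sub]
  rfl

theorem IsFramed.dirDeriv_dirDeriv (hF : IsFramed U f e ν)
    (hY : SmoothField f U Y) (hξ : ContMDiffOn (𝓡 n) 𝓘(ℝ, Amb n) ∞ ξ U) (hx : x ∈ U) :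
    dirDeriv X (dirDeriv Y ξ) x =
      dirDeriv X (fun y => differential f y (tangentConn f Y ξ y)) x +
        dirDeriv X (normalConn f Y ξ) x := by
  rw [dirDeriv_congr hF.isOpen (fun y _ => dirDeriv_eq_add f Y ξ y) hx, dirDeriv_eq,
    tderiv_add (hF.mdiff (hF.smooth_tangentConn hY hξ) hx)
      (hF.mdiff (hF.smooth_normalConn hY hξ) hx)]
  rfl

theorem IsFramed.normalPart_dirDeriv_dirDeriv (hF : IsFramed U f e ν)
    (hY : SmoothField f U Y) (hξ : ContMDiffOn (𝓡 n) 𝓘(ℝ, Amb n) ∞ ξ U) (hx : x ∈ U) :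
    normalPart f x (dirDeriv X (dirDeriv Y ξ) x) =
      secondFF f x (X x) (tangentConn f Y ξ x) + normalConn f X (normalConn f Y ξ) x := by
  rw [hF.dirDeriv_dirDeriv hY hξ hx, hF.secondFF_eq_normalConn (hF.smooth_tangentConn hY hξ) hx,
    normalPart_eq, map_add]
  rfl

theorem IsFramed.tangentComp_dirDeriv_dirDeriv (hF : IsFramed U f e ν)
    (hY : SmoothField f U Y) (hξ : ContMDiffOn (𝓡 n) 𝓘(ℝ, Amb n) ∞ ξ U) (hx : x ∈ U) :
    tangentComp f x (dirDeriv X (dirDeriv Y ξ) x) =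
      leviCivita f X (tangentConn f Y ξ) x + tangentConn f X (normalConn f Y ξ) x := by
  rw [hF.dirDeriv_dirDeriv hY hξ hx, tangentComp_eq_map, map_add]
  rfl

/-- The commutator of the normal connection; for a normal field this is Ricci's equation. -/
theorem IsFramed.normalConn_commutator (hF : IsFramed U f e ν) (hX : SmoothField f U X)
    (hY : SmoothField f U Y) (hξ : ContMDiffOn (𝓡 n) 𝓘(ℝ, Amb n) ∞ ξ U) (hx : x ∈ U) :
    normalConn f X (normalConn f Y ξ) x - normalConn f Y (normalConn f X ξ) x -
        (normalConn f (leviCivita f X Y) ξ x - normalConn f (leviCivita f Y X) ξ x) =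
      secondFF f x (Y x) (tangentConn f X ξ x) - secondFF f x (X x) (tangentConn f Y ξ x) := by
  have h := congrArg (normalPart f x) (hF.dirDeriv_commutator hX hY hξ hx)
  simp only [normalPart_eq, map_sub] at h
  simp only [← normalPart_eq] at h
  rw [hF.normalPart_dirDeriv_dirDeriv hY hξ hx, hF.normalPart_dirDeriv_dirDeriv hX hξ hx] at h
  have h2 : normalConn f (leviCivita f X Y) ξ x - normalConn f (leviCivita f Y X) ξ x = _ := h.symm
  rw [h2]
  abel

/-- The tangential part of the commutator; for a tangential field this is Gauss's equation. -/
theorem IsFramed.tangentConn_commutator (hF : IsFramed U f e ν) (hX : SmoothField f U X)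
    (hY : SmoothField f U Y) (hξ : ContMDiffOn (𝓡 n) 𝓘(ℝ, Amb n) ∞ ξ U) (hx : x ∈ U) :
    leviCivita f X (tangentConn f Y ξ) x - leviCivita f Y (tangentConn f X ξ) x -
        (tangentConn f (leviCivita f X Y) ξ x - tangentConn f (leviCivita f Y X) ξ x) =
      tangentConn f Y (normalConn f X ξ) x - tangentConn f X (normalConn f Y ξ) x := by
  have h := congrArg (tangentComp f x) (hF.dirDeriv_commutator hX hY hξ hx)
  simp only [tangentComp_eq_map, map_sub] at h
  simp only [← tangentComp_eq_map] at h
  rw [hF.tangentComp_dirDeriv_dirDeriv hY hξ hx, hF.tangentComp_dirDeriv_dirDeriv hX hξ hx] at h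
  have h2 : tangentConn f (leviCivita f X Y) ξ x - tangentConn f (leviCivita f Y X) ξ x = _ :=
    h.symm
  rw [h2]
  abel

/-- The Codazzi equation. -/
theorem IsFramed.nablaA_comm (hF : IsFramed U f e ν) (hX : SmoothField f U X)
    (hY : SmoothField f U Y) (hZ : SmoothField f U Z) (hx : x ∈ U) :
    nablaA f X Y Z x = nablaA f Y X Z x := by
  -- The commutator for `ξ = df(Z)`: its normal derivatives are values of `A` and its tangential
  -- derivatives are `∇Z`, so the curvature terms become the correction terms of `∇A`.
  have h := hF.normalConn_commutator hX hY hZ hx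
  rw [← hF.normalConn_congr (fun y hy => hF.secondFF_eq_normalConn hZ hy) hx,
    ← hF.normalConn_congr (fun y hy => hF.secondFF_eq_normalConn hZ hy) hx,
    ← hF.secondFF_eq_normalConn hZ hx, ← hF.secondFF_eq_normalConn hZ hx] at h
  have h2 : ∀ X, tangentConn f X (fun y => differential f y (Z y)) = leviCivita f X Z :=
    fun _ => rfl
  rw [h2, h2] at h
  unfold nablaA
  linear_combination (norm := module) (1 : ℝ) • h

theorem IsFramed.nablaA_symm (hF : IsFramed U f e ν) (hx : x ∈ U) :
    nablaA f Z X Y x = nablaA f Z Y X x := by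
  unfold nablaA
  rw [hF.normalConn_congr (fun y hy => hF.secondFF_symm hy (X y) (Y y)) hx,
    hF.secondFF_symm hx _ (Y x), hF.secondFF_symm hx (X x)]
  abel

theorem IsFramed.smooth_nablaA (hF : IsFramed U f e ν) (hZ : SmoothField f U Z)
    (hX : SmoothField f U X) (hY : SmoothField f U Y) :
    ContMDiffOn (𝓡 n) 𝓘(ℝ, Amb n) ∞ (nablaA f Z X Y) U :=
  ((hF.smooth_normalConn hZ (hF.smooth_secondFF hX hY)).sub
    (hF.smooth_secondFF (hF.smooth_leviCivita hZ hX) hY)).sub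
    (hF.smooth_secondFF hX (hF.smooth_leviCivita hZ hY))

theorem IsFramed.nabla2A_comm_left (hF : IsFramed U f e ν) (hW : SmoothField f U W)
    (hX : SmoothField f U X) (hY : SmoothField f U Y) (hZ : SmoothField f U Z) (hx : x ∈ U) :
    nabla2A f W Z X Y x = nabla2A f W X Z Y x := by
  unfold nabla2A
  rw [hF.normalConn_congr (fun y hy => hF.nablaA_comm hZ hX hY hy) hx,
    hF.nablaA_comm (hF.smooth_leviCivita hW hZ) hX hY hx,
    hF.nablaA_comm hZ (hF.smooth_leviCivita hW hX) hY hx,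
    hF.nablaA_comm hZ hX (hF.smooth_leviCivita hW hY) hx]
  abel

theorem IsFramed.nabla2A_symm (hF : IsFramed U f e ν) (hx : x ∈ U) :
    nabla2A f W Z X Y x = nabla2A f W Z Y X x := by
  unfold nabla2A
  rw [hF.normalConn_congr (fun y hy => hF.nablaA_symm (Z := Z) (X := X) (Y := Y) hy) hx,
    hF.nablaA_symm hx, hF.nablaA_symm (X := leviCivita f W X) hx, hF.nablaA_symm (X := X) hx]
  abel

theorem IsFramed.nabla2A_eq (hF : IsFramed U f e ν) (hX : SmoothField f U X)
    (hY : SmoothField f U Y) (hZ : SmoothField f U Z) (hx : x ∈ U) :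
    nabla2A f W Z X Y x =
      normalConn f W (normalConn f Z (fun y => secondFF f y (X y) (Y y))) x
        - normalConn f W (fun y => secondFF f y (leviCivita f Z X y) (Y y)) x
        - normalConn f W (fun y => secondFF f y (X y) (leviCivita f Z Y y)) x
        - nablaA f (leviCivita f W Z) X Y x
        - nablaA f Z (leviCivita f W X) Y x
        - nablaA f Z X (leviCivita f W Y) x := by
  rw [nabla2A]
  congr 3
  have hA := hF.smooth_normalConn hZ (hF.smooth_secondFF hX hY)
  have hL := hF.smooth_secondFF (hF.smooth_leviCivita hZ hX) hY
  have hR := hF.smooth_secondFF hX (hF.smooth_leviCivita hZ hY)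
  rw [← hF.normalConn_sub hA hL hx]
  exact hF.normalConn_sub (hA.sub hL) hR hx

/-- The Ricci identity for the second covariant derivative of the second fundamental form. -/
theorem IsFramed.nabla2A_commutator (hF : IsFramed U f e ν) (hW : SmoothField f U W)
    (hX : SmoothField f U X) (hY : SmoothField f U Y) (hZ : SmoothField f U Z) (hx : x ∈ U) :
    nabla2A f W Z X Y x - nabla2A f Z W X Y x =
      secondFF f x (Z x) (tangentConn f W (fun y => secondFF f y (X y) (Y y)) x)
        - secondFF f x (W x) (tangentConn f Z (fun y => secondFF f y (X y) (Y y)) x)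
        - (secondFF f x (tangentConn f Z (fun y => secondFF f y (W y) (X y)) x) (Y x)
          - secondFF f x (tangentConn f W (fun y => secondFF f y (Z y) (X y)) x) (Y x))
        - (secondFF f x (X x) (tangentConn f Z (fun y => secondFF f y (W y) (Y y)) x)
          - secondFF f x (X x) (tangentConn f W (fun y => secondFF f y (Z y) (Y y)) x)) := by
  -- Curvature acts on the value `A(X, Y)` through the normal bundle (`h0`) and on the two arguments
  -- through the tangent bundle (`h1`, `h2`). All three curvatures are kept in Weingarten form.
  have h0 := hF.normalConn_commutator hW hZ (hF.smooth_secondFF hX hY) hx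
  have h1 := hF.tangentConn_commutator hW hZ hX hx
  have h2 := hF.tangentConn_commutator hW hZ hY hx
  rw [← hF.tangentConn_congr (fun y hy => hF.secondFF_eq_normalConn hX hy) hx,
    ← hF.tangentConn_congr (fun y hy => hF.secondFF_eq_normalConn hX hy) hx] at h1
  rw [← hF.tangentConn_congr (fun y hy => hF.secondFF_eq_normalConn hY hy) hx,
    ← hF.tangentConn_congr (fun y hy => hF.secondFF_eq_normalConn hY hy) hx] at h2
  have h3 : ∀ V X : (y : M) → TangentSpace (𝓡 n) y,
    tangentConn f V (fun y => differential f y (X y)) = leviCivita f V X := fun _ _ => rfl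
  simp only [h3] at h1 h2
  have h1' := congrArg (fun v => secondFFL f x v (Y x)) h1
  have h2' := congrArg (fun v => secondFFL f x (X x) v) h2
  simp only [map_sub, LinearMap.sub_apply] at h1' h2'
  rw [hF.nabla2A_eq hX hY hZ hx, hF.nabla2A_eq hX hY hW hx]
  unfold nablaA
  simp only [secondFF_eq] at *
  linear_combination (norm := module) (1 : ℝ) • h0 - (1 : ℝ) • h1' - (1 : ℝ) • h2'

/-- The trace commutes with `∇`: the correction terms pair the skew connection form with the
symmetric `A`. -/
theorem IsFramed.sum_nablaA (hF : IsFramed U f e ν) (hx : x ∈ U) :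
    ∑ k, nablaA f Z (e k) (e k) x =
      normalConn f Z (fun y => ∑ k, secondFF f y (e k y) (e k y)) x := by
  have h : ∑ k, secondFF f x (leviCivita f Z (e k) x) (e k x) = 0 := by
    rw [← hF.sum_connection_smul (X := Z) hx
      (B := fun m k => secondFF f x (e m x) (e k x)) fun k m => hF.secondFF_symm hx _ _]
    refine Finset.sum_congr rfl fun k _ => ?_
    rw [hF.leviCivita_frame k hx, secondFF_eq]
    simp only [map_sum, map_smul, LinearMap.sum_apply, LinearMap.smul_apply]
    rfl
  have h' : ∀ k, secondFF f x (e k x) (leviCivita f Z (e k) x) =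
    secondFF f x (leviCivita f Z (e k) x) (e k x) := fun k => hF.secondFF_symm hx _ _
  rw [hF.normalConn_sum (fun k => hF.smooth_secondFF (hF.smooth_tangent k) (hF.smooth_tangent k))
    hx]
  simp only [nablaA, h', Finset.sum_sub_distrib, h, sub_zero]

/-- The trace of `∇²A` is the Hessian of the mean curvature vector. The connection form is now
paired with `(∇_{e_m} A)(Z, e_k)`, whose symmetry in `m, k` is Codazzi together with the symmetry of
`A`. -/
theorem IsFramed.sum_nabla2A (hF : IsFramed U f e ν) (hW : SmoothField f U W)
    (hZ : SmoothField f U Z) (hx : x ∈ U) :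
    ∑ k, nabla2A f W Z (e k) (e k) x =
      normalConn f W (normalConn f Z (fun y => ∑ k, secondFF f y (e k y) (e k y))) x -
        normalConn f (leviCivita f W Z) (fun y => ∑ k, secondFF f y (e k y) (e k y)) x := by
  have he : ∀ k, SmoothField f U (e k) := hF.smooth_tangent
  have h : ∑ k, nablaA f Z (leviCivita f W (e k)) (e k) x = 0 := by
    rw [← hF.sum_connection_smul (X := W) hx
      (B := fun m k => nablaA f (e m) Z (e k) x) fun k m => by
        rw [← hF.nablaA_comm hZ (he k) (he m) hx, hF.nablaA_symm hx,
          hF.nablaA_comm hZ (he m) (he k) hx]]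
    refine Finset.sum_congr rfl fun k _ => ?_
    rw [hF.nablaA_comm hZ (hF.smooth_leviCivita hW (he k)) (he k) hx]
    exact nablaA_sum_left _ e (hF.leviCivita_frame k hx)
  have h' : ∀ k, nablaA f Z (e k) (leviCivita f W (e k)) x =
    nablaA f Z (leviCivita f W (e k)) (e k) x := fun k => hF.nablaA_symm hx
  have h1 := hF.normalConn_congr (X := W) (fun y hy => hF.sum_nablaA (Z := Z) hy) hx
  rw [hF.normalConn_sum (fun k => hF.smooth_nablaA hZ (he k) (he k)) hx] at h1
  simp only [nabla2A, h', Finset.sum_sub_distrib, h, sub_zero, h1, hF.sum_nablaA hx]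

/-- Simons' identity. -/
theorem IsFramed.laplaceA_eq (hF : IsFramed U f e ν) (hx : x ∈ U) (i j : Fin n) :
    laplaceA f e (e i) (e j) x =
      normalConn f (e j) (normalConn f (e i) (fun y => ∑ k, secondFF f y (e k y) (e k y))) x
      - normalConn f (leviCivita f (e j) (e i)) (fun y => ∑ k, secondFF f y (e k y) (e k y)) x
      + ∑ k,
        (secondFF f x (e j x) (tangentConn f (e k) (fun y => secondFF f y (e i y) (e k y)) x)
        - secondFF f x (e k x) (tangentConn f (e j) (fun y => secondFF f y (e i y) (e k y)) x)
        - (secondFF f x (tangentConn f (e j) (fun y => secondFF f y (e k y) (e i y)) x) (e k x)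
          - secondFF f x (tangentConn f (e k) (fun y => secondFF f y (e j y) (e i y)) x) (e k x))
        - (secondFF f x (e i x) (tangentConn f (e j) (fun y => secondFF f y (e k y) (e k y)) x)
          - secondFF f x (e i x)
              (tangentConn f (e k) (fun y => secondFF f y (e j y) (e k y)) x))) := by
  have he : ∀ k, SmoothField f U (e k) := hF.smooth_tangent
  rw [← hF.sum_nabla2A (he j) (he i) hx, ← Finset.sum_add_distrib, laplaceA]
  refine Finset.sum_congr rfl fun k _ => ?_
  -- Codazzi and symmetry turn `∇²_{kk}A_{ij}` into `∇²_{kj}A_{ik}`, and `∇²_{ji}A_{kk}` into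
  -- `∇²_{jk}A_{ik}`; the two differ by the commutator.
  rw [← hF.nabla2A_commutator (he k) (he i) (he k) (he j) hx, hF.nabla2A_symm hx,
    hF.nabla2A_comm_left (he k) (he j) (he i) (he k) hx, hF.nabla2A_symm hx,
    hF.nabla2A_comm_left (he j) (he i) (he k) (he k) hx]
  abel

end StaticGeometry

/-- The right-hand side lists the curvature terms as `laplaceA_eq` yields them: normal bundle, slot
of `e_i`, slot of `e_k`. These are the third, second and first groups of `cubicQ`. -/
theorem cubicQ_eq {n : ℕ} {h : Fin 2 → Fin n → Fin n → ℝ} (hs : ∀ α i j, h α i j = h α j i)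
    (α : Fin 2) (i j : Fin n) :
    cubicQ h α i j =
      ∑ k, (((∑ m, (∑ β, h β i k * h β k m) * h α j m)
        - ∑ m, (∑ β, h β i k * h β j m) * h α k m)
        - ((∑ m, (∑ β, h β k i * h β j m) * h α m k)
          - ∑ m, (∑ β, h β j i * h β k m) * h α m k)
        - ((∑ m, (∑ β, h β k k * h β j m) * h α i m)
          - ∑ m, (∑ β, h β j k * h β k m) * h α i m)) := by
  have h1 : (∑ m, h α i m * ∑ β, ((∑ k, h β m k * h β k j) - h β m j * traceH h β)) =
      ∑ k, (-((∑ m, (∑ β, h β k k * h β j m) * h α i m)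
          - ∑ m, (∑ β, h β j k * h β k m) * h α i m)) := by
    simp only [← Finset.sum_sub_distrib, ← Finset.sum_neg_distrib]
    rw [Finset.sum_comm]
    refine Finset.sum_congr rfl fun m _ => ?_
    simp only [traceH, Fin.sum_univ_two, Finset.mul_sum, ← Finset.sum_sub_distrib,
      ← Finset.sum_add_distrib]
    refine Finset.sum_congr rfl fun k _ => ?_
    rw [hs 0 k j, hs 1 k j, hs 0 m k, hs 1 m k, hs 0 m j, hs 1 m j]
    ring
  have h2 : (∑ m, ∑ k, h α m k * ∑ β, (h β m k * h β i j - h β k i * h β m j)) =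
      ∑ k, (-((∑ m, (∑ β, h β k i * h β j m) * h α m k)
          - ∑ m, (∑ β, h β j i * h β k m) * h α m k)) := by
    rw [Finset.sum_comm]
    simp only [← Finset.sum_sub_distrib, ← Finset.sum_neg_distrib]
    refine Finset.sum_congr rfl fun k _ => Finset.sum_congr rfl fun m _ => ?_
    simp only [Fin.sum_univ_two]
    rw [hs 0 k m, hs 1 k m, hs 0 m j, hs 1 m j, hs 0 i j, hs 1 i j]
    ring
  have h3 : (∑ β, ∑ k, h β i k * ∑ l, (h β k l * h α l j - h α k l * h β l j)) =
      ∑ k, ((∑ m, (∑ β, h β i k * h β k m) * h α j m)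
        - ∑ m, (∑ β, h β i k * h β j m) * h α k m) := by
    rw [Finset.sum_comm]
    simp only [← Finset.sum_sub_distrib, Finset.mul_sum]
    refine Finset.sum_congr rfl fun k _ => ?_
    rw [Finset.sum_comm]
    refine Finset.sum_congr rfl fun m _ => ?_
    simp only [Fin.sum_univ_two]
    rw [hs 0 m j, hs 1 m j, hs α m j]
    ring
  rw [cubicQ, h1, h2, h3, ← Finset.sum_add_distrib, ← Finset.sum_add_distrib]
  refine Finset.sum_congr rfl fun k _ => ?_
  ring

/-- The rotation `w ↦ ⟨w, a⟩ b - ⟨w, b⟩ a`. -/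
def quarterTurn {n : ℕ} (a b w : Amb n) : Amb n :=
  (inner ℝ w a : ℝ) • b - (inner ℝ w b : ℝ) • a

/-! ### The quarter turn is parallel; Simons' identity in components -/

section StaticGeometry

variable {n : ℕ} {M : Type*} [TopologicalSpace M] [ChartedSpace (EuclideanSpace ℝ (Fin n)) M]
  {U : Set M} {f : M → Amb n} {e : Fin n → (x : M) → TangentSpace (𝓡 n) x}
  {ν : Fin 2 → M → Amb n} {X Y : (y : M) → TangentSpace (𝓡 n) y} {ξ : M → Amb n} {x : M}

theorem IsFramed.normal_eq_sum (hF : IsFramed U f e ν) (hx : x ∈ U) {v : Amb n}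
    (hv : ∀ u, inner ℝ v (differential f x u) = 0) :
    v = (inner ℝ v (ν 0 x) : ℝ) • ν 0 x + (inner ℝ v (ν 1 x) : ℝ) • ν 1 x := by
  conv_lhs => rw [← normalPart_of_normal (hF.orthonormal_tangent x hx) hv,
    normalPart_eq_sum (hF.orthonormal_tangent x hx) (hF.orthonormal_normal x hx) (hF.normal x hx),
    Fin.sum_univ_two]

theorem IsFramed.inner_normal (hF : IsFramed U f e ν) (hx : x ∈ U) {v : Amb n}
    (hv : ∀ u, inner ℝ v (differential f x u) = 0) (w : Amb n) :
    (inner ℝ v w : ℝ) = ∑ β, inner ℝ v (ν β x) * inner ℝ w (ν β x) := by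
  conv_lhs => rw [hF.normal_eq_sum hx hv]
  rw [inner_add_left, real_inner_smul_left, real_inner_smul_left, Fin.sum_univ_two,
    real_inner_comm w, real_inner_comm w]

theorem IsFramed.inner_normal_frame (hF : IsFramed U f e ν) (hx : x ∈ U) (α β : Fin 2) :
    (inner ℝ (ν α x) (ν β x) : ℝ) = if α = β then 1 else 0 :=
  orthonormal_iff_ite.1 (hF.orthonormal_normal x hx) α β

theorem IsFramed.inner_dirDeriv_normal (hF : IsFramed U f e ν) (hx : x ∈ U) (α β : Fin 2) :
    (inner ℝ (dirDeriv X (ν α) x) (ν β x) : ℝ) = -inner ℝ (ν α x) (dirDeriv X (ν β) x) :=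
  inner_tderiv_of_const hF.isOpen hx (fun _ hy => hF.inner_normal_frame hy α β)
    (hF.mdiff (hF.smooth_normal α) hx) (hF.mdiff (hF.smooth_normal β) hx) (X x)

theorem IsFramed.smooth_quarterTurn (hF : IsFramed U f e ν)
    (hξ : ContMDiffOn (𝓡 n) 𝓘(ℝ, Amb n) ∞ ξ U) :
    ContMDiffOn (𝓡 n) 𝓘(ℝ, Amb n) ∞ (fun y => quarterTurn (ν 0 y) (ν 1 y) (ξ y)) U :=
  ((contMDiffOn_inner hξ (hF.smooth_normal 0)).smul (hF.smooth_normal 1)).sub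
    ((contMDiffOn_inner hξ (hF.smooth_normal 1)).smul (hF.smooth_normal 0))

/-- Plane rotations commute with the skew connection form of `ν_0, ν_1`, so the quarter turn is
parallel although the frame need not be parallel in space. -/
theorem IsFramed.normalConn_quarterTurn (hF : IsFramed U f e ν)
    (hξ : ContMDiffOn (𝓡 n) 𝓘(ℝ, Amb n) ∞ ξ U)
    (hn : ∀ y ∈ U, ∀ u, inner ℝ (ξ y) (differential f y u) = 0) (hx : x ∈ U) :
    normalConn f X (fun y => quarterTurn (ν 0 y) (ν 1 y) (ξ y)) x =
      quarterTurn (ν 0 x) (ν 1 x) (normalConn f X ξ x) := by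
  have hξx := hF.mdiff hξ hx
  have hν := fun α => hF.mdiff (hF.smooth_normal α) hx
  have ha := fun α => mdifferentiableAt_inner hξx (hν α)
  have h1 : dirDeriv X (fun y => quarterTurn (ν 0 y) (ν 1 y) (ξ y)) x =
      ((inner ℝ (ξ x) (dirDeriv X (ν 0) x) + inner ℝ (dirDeriv X ξ x) (ν 0 x) : ℝ) • ν 1 x +
        (inner ℝ (ξ x) (ν 0 x) : ℝ) • dirDeriv X (ν 1) x) -
      ((inner ℝ (ξ x) (dirDeriv X (ν 1) x) + inner ℝ (dirDeriv X ξ x) (ν 1 x) : ℝ) • ν 0 x +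
        (inner ℝ (ξ x) (ν 1 x) : ℝ) • dirDeriv X (ν 0) x) := by
    have h2 : tderiv n (fun y => quarterTurn (ν 0 y) (ν 1 y) (ξ y)) x = _ :=
      tderiv_sub (mdifferentiableAt_smul (ha 0) (hν 1)) (mdifferentiableAt_smul (ha 1) (hν 0))
    rw [dirDeriv_eq, h2, sub_apply]
    rw [tderiv_smul (ha 0) (hν 1), tderiv_smul (ha 1) (hν 0), tderiv_inner hξx (hν 0),
      tderiv_inner hξx (hν 1)]
    rfl
  have hin : ∀ β, (inner ℝ (ξ x) (dirDeriv X (ν β) x) : ℝ) =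
      inner ℝ (ξ x) (ν 0 x) * inner ℝ (dirDeriv X (ν β) x) (ν 0 x) +
      inner ℝ (ξ x) (ν 1 x) * inner ℝ (dirDeriv X (ν β) x) (ν 1 x) := fun β => by
    rw [hF.inner_normal hx (hn x hx), Fin.sum_univ_two]
  have h00 : (inner ℝ (dirDeriv X (ν 0) x) (ν 0 x) : ℝ) = 0 := by
    have h := hF.inner_dirDeriv_normal (X := X) hx 0 0
    rw [real_inner_comm] at h
    rw [real_inner_comm]
    linarith
  have h11 : (inner ℝ (dirDeriv X (ν 1) x) (ν 1 x) : ℝ) = 0 := by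
    have h := hF.inner_dirDeriv_normal (X := X) hx 1 1
    rw [real_inner_comm] at h
    rw [real_inner_comm]
    linarith
  have o00 := hF.inner_normal_frame hx 0 0
  have o01 := hF.inner_normal_frame hx 0 1
  have o10 := hF.inner_normal_frame hx 1 0
  have o11 := hF.inner_normal_frame hx 1 1
  simp only [Fin.isValue, if_true, zero_ne_one, one_ne_zero, if_false] at o00 o01 o10 o11
  have e0 : (inner ℝ (normalConn f X ξ x) (ν 0 x) : ℝ) = inner ℝ (dirDeriv X ξ x) (ν 0 x) :=
    inner_normalPart (ν := fun α => ν α x) (hF.normal x hx) _ 0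
  have e1 : (inner ℝ (normalConn f X ξ x) (ν 1 x) : ℝ) = inner ℝ (dirDeriv X ξ x) (ν 1 x) :=
    inner_normalPart (ν := fun α => ν α x) (hF.normal x hx) _ 1
  rw [normalConn, normalPart_eq_sum (hF.orthonormal_tangent x hx) (hF.orthonormal_normal x hx)
    (hF.normal x hx), h1, Fin.sum_univ_two, quarterTurn, e0, e1]
  simp only [inner_sub_left, inner_add_left, real_inner_smul_left, hin, h00, h11, o00, o01, o10,
    o11]
  module

theorem IsFramed.secondFF_normal (hF : IsFramed U f e ν) (hx : x ∈ U)
    (u v w : TangentSpace (𝓡 n) x) :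
    inner ℝ (secondFF f x u v) (differential f x w) = 0 :=
  hF.inner_normalPart_eq_zero hx _ w

variable [IsManifold (𝓡 n) ∞ M]

/-- By Weingarten, the tangential part of `D_{e_k}(A(e_a, e_b))` has components `-⟨A(e_a, e_b),
A(e_k, e_m)⟩`; this product is expanded in the normal frame. -/
theorem IsFramed.inner_secondFF_tangentConn (hF : IsFramed U f e ν) (hx : x ∈ U) (α : Fin 2)
    (a b k : Fin n) (u : TangentSpace (𝓡 n) x) :
    (inner ℝ (secondFF f x u (tangentConn f (e k) (fun y => secondFF f y (e a y) (e b y)) x))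
      (ν α x) : ℝ) =
    -∑ m, (∑ β, inner ℝ (secondFF f x (e a x) (e b x)) (ν β x) *
      inner ℝ (secondFF f x (e k x) (e m x)) (ν β x)) *
        inner ℝ (secondFF f x u (e m x)) (ν α x) := by
  have he : ∀ k, SmoothField f U (e k) := hF.smooth_tangent
  rw [hF.tangentConn_eq (hF.smooth_secondFF (he a) (he b))
    (fun y hy => hF.secondFF_normal hy _ _) hx, secondFF_eq]
  simp only [map_neg, map_sum, map_smul, inner_neg_left, sum_inner, real_inner_smul_left]
  congr 1
  refine Finset.sum_congr rfl fun m _ => ?_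
  congr 1
  rw [dirDeriv_eq_add f, inner_add_right, hF.secondFF_normal hx, zero_add,
    ← hF.secondFF_eq_normalConn (he m) hx, hF.inner_normal hx (hF.secondFF_normal hx _ _)]

/-- Simons' identity in components. -/
theorem IsFramed.inner_laplaceA (hF : IsFramed U f e ν) (hx : x ∈ U) (α : Fin 2) (i j : Fin n)
    {h : Fin 2 → Fin n → Fin n → ℝ}
    (hh : ∀ α i j, h α i j = inner ℝ (secondFF f x (e i x) (e j x)) (ν α x)) :
    (inner ℝ (normalConn f (e j) (normalConn f (e i)
        (fun y => ∑ k, secondFF f y (e k y) (e k y))) x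
      - normalConn f (leviCivita f (e j) (e i)) (fun y => ∑ k, secondFF f y (e k y) (e k y)) x)
      (ν α x) : ℝ) = inner ℝ (laplaceA f e (e i) (e j) x) (ν α x) + cubicQ h α i j := by
  have hs : ∀ α i j, h α i j = h α j i := fun α i j => by rw [hh, hh, hF.secondFF_symm hx]
  have hl : ∀ (k : Fin n) (u : TangentSpace (𝓡 n) x), secondFF f x u (e k x) =
    secondFF f x (e k x) u := fun k u => hF.secondFF_symm hx _ _
  rw [hF.laplaceA_eq hx, cubicQ_eq hs]
  simp only [hl _ (tangentConn f _ _ x)]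
  simp only [inner_sub_left, inner_add_left, sum_inner, hF.inner_secondFF_tangentConn hx, ← hh]
  rw [add_assoc, ← Finset.sum_add_distrib, Finset.sum_eq_zero, add_zero]
  intro k _
  simp only [hs α _ k]
  ring

theorem IsFramed.hessian_quarterTurn (hF : IsFramed U f e ν) (hX : SmoothField f U X)
    (hξ : ContMDiffOn (𝓡 n) 𝓘(ℝ, Amb n) ∞ ξ U)
    (hn : ∀ y ∈ U, ∀ u, inner ℝ (ξ y) (differential f y u) = 0) (hx : x ∈ U) :
    normalConn f Y (normalConn f X (fun y => quarterTurn (ν 0 y) (ν 1 y) (ξ y))) x -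
        normalConn f (leviCivita f Y X) (fun y => quarterTurn (ν 0 y) (ν 1 y) (ξ y)) x =
      quarterTurn (ν 0 x) (ν 1 x) (normalConn f Y (normalConn f X ξ) x -
        normalConn f (leviCivita f Y X) ξ x) := by
  rw [hF.normalConn_congr (fun y hy => hF.normalConn_quarterTurn (X := X) hξ hn hy) hx,
    hF.normalConn_quarterTurn (hF.smooth_normalConn hX hξ)
      (fun y hy => hF.inner_normalPart_eq_zero hy _) hx, hF.normalConn_quarterTurn hξ hn hx]
  simp only [quarterTurn, inner_sub_left]
  module

end StaticGeometry

/-! ### Mixed time and space derivatives up to the end points of the interval -/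

section MixedPartials

variable {E G : Type*} [NormedAddCommGroup E] [NormedSpace ℝ E] [NormedAddCommGroup G]
  [NormedSpace ℝ G] {I : Set ℝ} {V : Set E} {ζ : ℝ × E → G}

theorem interior_nonempty_of_nontrivial (hI : I.OrdConnected) (hI' : I.Nontrivial) :
    (interior I).Nonempty := by
  obtain ⟨a, ha, b, hb, hab⟩ := hI'.exists_lt
  refine ⟨(a + b) / 2, interior_mono (hI.out ha hb) ?_⟩
  rw [interior_Icc]
  constructor <;> linarith

theorem uniqueDiffOn_interval (hI : I.OrdConnected) (hI' : I.Nontrivial) : UniqueDiffOn ℝ I :=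
  uniqueDiffOn_convex hI.convex (interior_nonempty_of_nontrivial hI hI')

theorem fderiv_slice (hV : IsOpen V) (hζ : ContDiffOn ℝ ∞ ζ (I ×ˢ V))
    {s : ℝ} (hs : s ∈ I) {p : E} (hp : p ∈ V) :
    fderiv ℝ (fun q => ζ (s, q)) p =
      fderivWithin ℝ ζ (I ×ˢ V) (s, p) ∘L ContinuousLinearMap.inr ℝ ℝ E := by
  have h1 := (hζ.differentiableOn (by simp) (s, p) ⟨hs, hp⟩).hasFDerivWithinAt
  have h2 : HasFDerivWithinAt (fun q : E => (s, q)) (ContinuousLinearMap.inr ℝ ℝ E) V p :=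
    (hasFDerivAt_prodMk_right s p).hasFDerivWithinAt
  have h3 := h1.comp p h2 fun q hq => ⟨hs, hq⟩
  exact (h3.hasFDerivAt (hV.mem_nhds hp)).fderiv

theorem hasDerivWithinAt_slice (hζ : ContDiffOn ℝ ∞ ζ (I ×ˢ V))
    {s : ℝ} (hs : s ∈ I) {p : E} (hp : p ∈ V) :
    HasDerivWithinAt (fun t => ζ (t, p)) (fderivWithin ℝ ζ (I ×ˢ V) (s, p) (1, 0)) I s := by
  have h1 := (hζ.differentiableOn (by simp) (s, p) ⟨hs, hp⟩).hasFDerivWithinAt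
  have h2 : HasDerivWithinAt (fun t : ℝ => (t, p)) (1, 0) I s :=
    (hasDerivWithinAt_id s I).prodMk (hasDerivWithinAt_const s I p)
  have h3 : Set.MapsTo (fun t : ℝ => (t, p)) I (I ×ˢ V) := fun t ht => ⟨ht, hp⟩
  exact h1.comp_hasDerivWithinAt s h2 h3

theorem contDiffOn_fderiv_slice (hI : UniqueDiffOn ℝ I) (hV : IsOpen V)
    (hζ : ContDiffOn ℝ ∞ ζ (I ×ˢ V)) {p : E} (hp : p ∈ V) :
    ContDiffOn ℝ ∞ (fun s => fderiv ℝ (fun q => ζ (s, q)) p) I := by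
  have hS := hI.prod hV.uniqueDiffOn
  have h1 : ContDiffOn ℝ ∞ (fderivWithin ℝ ζ (I ×ˢ V)) (I ×ˢ V) :=
    hζ.fderivWithin hS (by simp)
  have h2 : ContDiffOn ℝ ∞ (fun s : ℝ => fderivWithin ℝ ζ (I ×ˢ V) (s, p)) I :=
    h1.comp (contDiff_id.prodMk contDiff_const).contDiffOn fun s hs => ⟨hs, hp⟩
  exact (h2.clm_comp contDiffOn_const).congr fun s hs => fderiv_slice hV hζ hs hp

/-- The time derivative commutes with the space derivative, up to the end points of the time
interval. -/
theorem hasDerivWithinAt_fderiv_slice (hI : I.OrdConnected) (hI' : I.Nontrivial) (hV : IsOpen V)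
    (hζ : ContDiffOn ℝ ∞ ζ (I ×ˢ V)) {t : ℝ} (ht : t ∈ I) {p : E} (hp : p ∈ V) :
    HasDerivWithinAt (fun s => fderiv ℝ (fun q => ζ (s, q)) p)
      (fderiv ℝ (fun q => derivWithin (fun s => ζ (s, q)) I t) p) I t := by
  have hU := uniqueDiffOn_interval hI hI'
  have hS := hU.prod hV.uniqueDiffOn
  have h1 : ContDiffOn ℝ ∞ (fderivWithin ℝ ζ (I ×ˢ V)) (I ×ˢ V) :=
    hζ.fderivWithin hS (by simp)
  have hmem : (t, p) ∈ I ×ˢ V := ⟨ht, hp⟩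
  have hD := (h1.differentiableOn (by simp) (t, p) hmem).hasFDerivWithinAt
  set D := fderivWithin ℝ (fderivWithin ℝ ζ (I ×ˢ V)) (I ×ˢ V) (t, p) with hDdef
  -- The second derivative within a set is symmetric at limits of interior points. In an interval
  -- with more than one point even the end points are such limits.
  have hcl : (t, p) ∈ closure (interior (I ×ˢ V)) := by
    rw [interior_prod_eq, closure_prod_eq, hV.interior_eq,
      (hI.convex : Convex ℝ I).closure_interior_eq_closure_of_nonempty_interior
        (interior_nonempty_of_nontrivial hI hI')]
    exact ⟨subset_closure ht, subset_closure hp⟩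
  have hsymm : IsSymmSndFDerivWithinAt ℝ ζ (I ×ˢ V) (t, p) :=
    (hζ (t, p) hmem).isSymmSndFDerivWithinAt
      (by rw [minSmoothness_of_isRCLikeNormedField]
          exact WithTop.coe_le_coe.2 (le_top (a := (2 : ℕ∞)))) hS hcl hmem
  have ha : HasDerivWithinAt (fun s : ℝ => fderivWithin ℝ ζ (I ×ˢ V) (s, p)) (D (1, 0)) I t := by
    have hm : Set.MapsTo (fun s : ℝ => (s, p)) I (I ×ˢ V) := fun s hs => ⟨hs, hp⟩
    exact hD.comp_hasDerivWithinAt t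
      ((hasDerivWithinAt_id t I).prodMk (hasDerivWithinAt_const t I p)) hm
  have hb : HasDerivWithinAt (fun s => fderiv ℝ (fun q => ζ (s, q)) p)
      (D (1, 0) ∘L ContinuousLinearMap.inr ℝ ℝ E) I t := by
    have h2 := ((ContinuousLinearMap.compL ℝ E (ℝ × E) G).flip
      (ContinuousLinearMap.inr ℝ ℝ E)).hasFDerivAt.comp_hasDerivWithinAt t ha
    exact h2.congr (fun s hs => fderiv_slice hV hζ hs hp) (fderiv_slice hV hζ ht hp)
  have hc : HasFDerivAt (fun q => fderivWithin ℝ ζ (I ×ˢ V) (t, q))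
      (D ∘L ContinuousLinearMap.inr ℝ ℝ E) p :=
    (hD.comp p (hasFDerivAt_prodMk_right t p).hasFDerivWithinAt
      fun q (hq : q ∈ V) => (⟨ht, hq⟩ : (t, q) ∈ I ×ˢ V)).hasFDerivAt (hV.mem_nhds hp)
  have hd := (ContinuousLinearMap.apply ℝ G ((1, 0) : ℝ × E)).hasFDerivAt.comp p hc
  have heq : (fun q => derivWithin (fun s => ζ (s, q)) I t) =ᶠ[nhds p]
      fun q => fderivWithin ℝ ζ (I ×ˢ V) (t, q) (1, 0) := by
    filter_upwards [hV.mem_nhds hp] with q hq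
    exact (hasDerivWithinAt_slice hζ ht hq).derivWithin (hU t ht)
  have hfin : fderiv ℝ (fun q => derivWithin (fun s => ζ (s, q)) I t) p =
      D (1, 0) ∘L ContinuousLinearMap.inr ℝ ℝ E := by
    rw [heq.fderiv_eq]
    refine hd.fderiv.trans ?_
    ext v
    exact hsymm (0, v) (1, 0)
  rw [hfin]
  exact hb

end MixedPartials

/-! ### Time-dependent maps on the manifold -/

section Time

variable {n : ℕ} {M : Type*} [TopologicalSpace M] [ChartedSpace (EuclideanSpace ℝ (Fin n)) M]
  {G : Type*} [NormedAddCommGroup G] [NormedSpace ℝ G] {I : Set ℝ} {U : Set M} {ξ : ℝ → M → G}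

theorem contMDiffOn_slice
    (hξ : ContMDiffOn (𝓘(ℝ, ℝ).prod (𝓡 n)) 𝓘(ℝ, G) ∞ (fun p : ℝ × M => ξ p.1 p.2) (I ×ˢ U))
    {t : ℝ} (ht : t ∈ I) : ContMDiffOn (𝓡 n) 𝓘(ℝ, G) ∞ (ξ t) U :=
  hξ.comp (contMDiff_const.prodMk contMDiff_id).contMDiffOn fun _ hy => ⟨ht, hy⟩

variable [IsManifold (𝓡 n) ∞ M]

theorem contDiffOn_time_chart
    (hξ : ContMDiffOn (𝓘(ℝ, ℝ).prod (𝓡 n)) 𝓘(ℝ, G) ∞ (fun p : ℝ × M => ξ p.1 p.2) (I ×ˢ U))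
    (x : M) :
    ContDiffOn ℝ ∞ (fun p : ℝ × EuclideanSpace ℝ (Fin n) => ξ p.1 ((extChartAt (𝓡 n) x).symm p.2))
      (I ×ˢ ((extChartAt (𝓡 n) x).target ∩ (extChartAt (𝓡 n) x).symm ⁻¹' U)) := by
  rw [← contMDiffOn_iff_contDiffOn]
  have h1 : ContMDiffOn 𝓘(ℝ, ℝ × EuclideanSpace ℝ (Fin n)) (𝓡 n) ∞
      (fun p : ℝ × EuclideanSpace ℝ (Fin n) => (extChartAt (𝓡 n) x).symm p.2)
      (I ×ˢ ((extChartAt (𝓡 n) x).target ∩ (extChartAt (𝓡 n) x).symm ⁻¹' U)) :=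
    (contMDiffOn_extChartAt_symm x).comp contDiff_snd.contMDiff.contMDiffOn fun p hp => hp.2.1
  have h2 : ContMDiffOn 𝓘(ℝ, ℝ × EuclideanSpace ℝ (Fin n)) 𝓘(ℝ, ℝ) ∞
      (fun p : ℝ × EuclideanSpace ℝ (Fin n) => p.1)
      (I ×ˢ ((extChartAt (𝓡 n) x).target ∩ (extChartAt (𝓡 n) x).symm ⁻¹' U)) :=
    contDiff_fst.contMDiff.contMDiffOn
  exact hξ.comp (h2.prodMk h1) fun p hp => ⟨hp.1, hp.2.2⟩

theorem hasDerivWithinAt_time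
    (hξ : ContMDiffOn (𝓘(ℝ, ℝ).prod (𝓡 n)) 𝓘(ℝ, G) ∞ (fun p : ℝ × M => ξ p.1 p.2) (I ×ˢ U))
    {t : ℝ} (ht : t ∈ I) {x : M} (hx : x ∈ U) :
    HasDerivWithinAt (fun s => ξ s x) (derivWithin (fun s => ξ s x) I t) I t := by
  have h := hasDerivWithinAt_slice (contDiffOn_time_chart hξ x) ht
    (mem_chart_preimage (mem_extChartAt_source (I := 𝓡 n) x) hx)
  simp only [extChartAt_to_inv] at h
  exact h.differentiableWithinAt.hasDerivWithinAt

/-- The differential at `x`, as a map on the model space. -/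
def tderivModel (n : ℕ) [ChartedSpace (EuclideanSpace ℝ (Fin n)) M] (ξ : M → G) (x : M) :
    EuclideanSpace ℝ (Fin n) →L[ℝ] G :=
  tderiv n ξ x

theorem contDiffOn_tderivModel
    (hξ : ContMDiffOn (𝓘(ℝ, ℝ).prod (𝓡 n)) 𝓘(ℝ, G) ∞ (fun p : ℝ × M => ξ p.1 p.2) (I ×ˢ U))
    (hU : IsOpen U) (hI : UniqueDiffOn ℝ I) {x : M} (hx : x ∈ U) :
    ContDiffOn ℝ ∞ (fun s => tderivModel n (ξ s) x) I :=
  (contDiffOn_fderiv_slice hI (isOpen_chart_preimage hU x) (contDiffOn_time_chart hξ x)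
    (mem_chart_preimage (mem_extChartAt_source (I := 𝓡 n) x) hx)).congr fun _ hs =>
      tderiv_eq_fderiv (mdifferentiableAt_of_contMDiffOn hU (contMDiffOn_slice hξ hs) hx)

theorem hasDerivWithinAt_tderivModel
    (hξ : ContMDiffOn (𝓘(ℝ, ℝ).prod (𝓡 n)) 𝓘(ℝ, G) ∞ (fun p : ℝ × M => ξ p.1 p.2) (I ×ˢ U))
    (hU : IsOpen U) (hI : I.OrdConnected) (hI' : I.Nontrivial) {t : ℝ} (ht : t ∈ I) {x : M}
    (hx : x ∈ U) {η : M → G} (hη : ContMDiffOn (𝓡 n) 𝓘(ℝ, G) ∞ η U)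
    (hη' : ∀ y ∈ U, derivWithin (fun s => ξ s y) I t = η y) :
    HasDerivWithinAt (fun s => tderivModel n (ξ s) x) (tderivModel n η x) I t := by
  have hp := mem_chart_preimage (mem_extChartAt_source (I := 𝓡 n) x) hx
  have hV := isOpen_chart_preimage (n := n) hU x
  have h := hasDerivWithinAt_fderiv_slice hI hI' hV (contDiffOn_time_chart hξ x) ht hp
  have h1 : tderivModel n η x = fderiv ℝ (fun q => derivWithin
      (fun s => ξ s ((extChartAt (𝓡 n) x).symm q)) I t) (extChartAt (𝓡 n) x x) := by
    refine (tderiv_eq_fderiv (mdifferentiableAt_of_contMDiffOn hU hη hx)).trans ?_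
    refine Filter.EventuallyEq.fderiv_eq ?_
    filter_upwards [hV.mem_nhds hp] with q hq
    exact (hη' _ hq.2).symm
  rw [h1]
  exact h.congr (fun s hs =>
      tderiv_eq_fderiv (mdifferentiableAt_of_contMDiffOn hU (contMDiffOn_slice hξ hs) hx))
    (tderiv_eq_fderiv (mdifferentiableAt_of_contMDiffOn hU (contMDiffOn_slice hξ ht) hx))

end Time

theorem continuousOn_det {I : Set ℝ} {k : ℕ} {A : ℝ → Matrix (Fin k) (Fin k) ℝ}
    (h : ∀ i j, ContinuousOn (fun s => A s i j) I) : ContinuousOn (fun s => (A s).det) I :=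
  (Continuous.matrix_det continuous_id).comp_continuousOn
    (continuousOn_pi.2 fun i => continuousOn_pi.2 fun j => h i j)

theorem eq_one_of_sq_eq_one {I : Set ℝ} (hI : I.OrdConnected) {c : ℝ → ℝ} (hc : ContinuousOn c I)
    (hsq : ∀ s ∈ I, c s ^ 2 = 1) {t₀ t : ℝ} (ht₀ : t₀ ∈ I) (h₀ : c t₀ = 1) (ht : t ∈ I) :
    c t = 1 := by
  rcases hI.isPreconnected.eq_or_eq_neg_of_sq_eq hc (continuousOn_const (c := (1 : ℝ)))
    (fun s hs => (hsq s hs).trans (one_pow 2).symm) (fun _ => one_ne_zero) with h | h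
  · exact h ht
  · have h2 : c t₀ = -1 := h ht₀
    rw [h₀] at h2
    norm_num at h2

/-! ### The flow in temporal gauge: orientation, velocity, motion of the frame -/

section FlowFrame

variable {n : ℕ} {M : Type*} [TopologicalSpace M] [ChartedSpace (EuclideanSpace ℝ (Fin n)) M]
  {I : Set ℝ} {U : Set M} {F : ℝ → M → Amb n}
  {e : Fin n → ℝ → (x : M) → TangentSpace (𝓡 n) x} {ν : Fin 2 → ℝ → M → Amb n} {t : ℝ} {x : M}

theorem IsSMCF.contMDiffOn (hF : IsSMCF I F) (U : Set M) :
    ContMDiffOn (𝓘(ℝ, ℝ).prod (𝓡 n)) 𝓘(ℝ, Amb n) ∞ (fun p : ℝ × M => F p.1 p.2) (I ×ˢ U) :=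
  hF.smooth.mono (Set.prod_mono_right (Set.subset_univ U))

theorem IsTemporalGauge.isFramed (hG : IsTemporalGauge I U F e ν) (hF : IsSMCF I F)
    (hU : IsOpen U) (ht : t ∈ I) : IsFramed U (F t) (fun i => e i t) (fun α => ν α t) where
  isOpen := hU
  smooth := contMDiffOn_slice (hF.contMDiffOn U) ht
  smooth_tangent i :=
    contMDiffOn_slice (ξ := fun s y => differential (F s) y (e i s y)) (hG.smooth_tangent i) ht
  smooth_normal α := contMDiffOn_slice (hG.smooth_normal α) ht
  orthonormal_tangent := hG.orthonormal_tangent t ht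
  orthonormal_normal := hG.orthonormal_normal t ht
  normal := hG.normal t ht

/-- The mean curvature vector, as the trace of the second fundamental form in the frame. -/
def frameMeanCurvature (F : ℝ → M → Amb n) (e : Fin n → ℝ → (x : M) → TangentSpace (𝓡 n) x)
    (t : ℝ) (y : M) : Amb n :=
  ∑ k, secondFF (F t) y (e k t y) (e k t y)

/-- The velocity of the flow in the frame. -/
def frameVelocity (F : ℝ → M → Amb n) (e : Fin n → ℝ → (x : M) → TangentSpace (𝓡 n) x)
    (ν : Fin 2 → ℝ → M → Amb n) (t : ℝ) (y : M) : Amb n :=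
  quarterTurn (ν 0 t y) (ν 1 t y) (frameMeanCurvature F e t y)

theorem IsTemporalGauge.frameMeanCurvature_normal (hG : IsTemporalGauge I U F e ν)
    (hF : IsSMCF I F) (hU : IsOpen U) (ht : t ∈ I) :
    ∀ y ∈ U, ∀ u, inner ℝ (frameMeanCurvature F e t y) (differential (F t) y u) = 0 := by
  intro y hy u
  rw [frameMeanCurvature, sum_inner]
  exact Finset.sum_eq_zero fun k _ => (hG.isFramed hF hU ht).secondFF_normal hy _ _ _

theorem IsTemporalGauge.frameVelocity_normal (hG : IsTemporalGauge I U F e ν) (ht : t ∈ I) :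
    ∀ y ∈ U, ∀ u, inner ℝ (frameVelocity F e ν t y) (differential (F t) y u) = 0 := by
  intro y hy u
  rw [frameVelocity, quarterTurn, inner_sub_left, real_inner_smul_left, real_inner_smul_left,
    hG.normal t ht y hy, hG.normal t ht y hy, mul_zero, mul_zero, sub_zero]

theorem inner_frameMeanCurvature (F : ℝ → M → Amb n)
    (e : Fin n → ℝ → (x : M) → TangentSpace (𝓡 n) x) (ν : Fin 2 → ℝ → M → Amb n) (t : ℝ) (x : M)
    (α : Fin 2) :
    (inner ℝ (frameMeanCurvature F e t x) (ν α t x) : ℝ) = traceH (coeffA F e ν t x) α := by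
  rw [frameMeanCurvature, sum_inner]
  rfl

variable [IsManifold (𝓡 n) ∞ M]

theorem IsTemporalGauge.smooth_frameMeanCurvature (hG : IsTemporalGauge I U F e ν)
    (hF : IsSMCF I F) (hU : IsOpen U) (ht : t ∈ I) :
    ContMDiffOn (𝓡 n) 𝓘(ℝ, Amb n) ∞ (frameMeanCurvature F e t) U := by
  have hS := hG.isFramed hF hU ht
  exact contMDiffOn_finsetSum fun k _ =>
    hS.smooth_secondFF (hS.smooth_tangent k) (hS.smooth_tangent k)

theorem IsTemporalGauge.smooth_frameVelocity (hG : IsTemporalGauge I U F e ν)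
    (hF : IsSMCF I F) (hU : IsOpen U) (ht : t ∈ I) :
    ContMDiffOn (𝓡 n) 𝓘(ℝ, Amb n) ∞ (frameVelocity F e ν t) U :=
  (hG.isFramed hF hU ht).smooth_quarterTurn (hG.smooth_frameMeanCurvature hF hU ht)

theorem IsSMCF.continuousOn_differential (hF : IsSMCF I F) (hI : I.OrdConnected)
    (hI' : I.Nontrivial) (x : M) (v : TangentSpace (𝓡 n) x) :
    ContinuousOn (fun s => differential (F s) x v) I := by
  have h := (contDiffOn_tderivModel hF.smooth isOpen_univ (uniqueDiffOn_interval hI hI')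
    (Set.mem_univ x)).continuousOn
  exact h.clm_apply continuousOn_const

theorem continuousOn_snoc2 {a : ℝ → Fin n → Amb n} {v w : ℝ → Amb n}
    (ha : ∀ i, ContinuousOn (fun s => a s i) I) (hv : ContinuousOn v I) (hw : ContinuousOn w I)
    (r : Fin (n + 2)) : ContinuousOn (fun s => snoc2 (a s) (v s) (w s) r) I := by
  induction r using Fin.lastCases with
  | last => simpa only [snoc2_last] using hw
  | cast r =>
    induction r using Fin.lastCases with
    | last => simpa only [snoc2_penultimate] using hv
    | cast r => simpa only [snoc2_castSucc] using ha r

theorem continuousOn_ambDet {a : ℝ → Fin n → Amb n} {v w : ℝ → Amb n}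
    (ha : ∀ i, ContinuousOn (fun s => a s i) I) (hv : ContinuousOn v I) (hw : ContinuousOn w I) :
    ContinuousOn (fun s => ambDet n (snoc2 (a s) (v s) (w s))) I := by
  simp only [ambDet_apply]
  exact continuousOn_det fun r i => (EuclideanSpace.proj (𝕜 := ℝ) i).continuous.comp_continuousOn
    (continuousOn_snoc2 ha hv hw r)

theorem IsTemporalGauge.continuousOn_inner_rotJ (hG : IsTemporalGauge I U F e ν) (hF : IsSMCF I F)
    (hI : I.OrdConnected) (hI' : I.Nontrivial) (hx : x ∈ U) :
    ContinuousOn (fun s => (inner ℝ (rotJ (F s) x (ν 0 s x)) (ν 1 s x) : ℝ)) I := by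
  have hν : ∀ α, ContinuousOn (fun s => ν α s x) I := fun α s hs =>
    (hasDerivWithinAt_time (hG.smooth_normal α) hs hx).continuousWithinAt
  have hd := fun k => hF.continuousOn_differential hI hI' x (coordVec x k)
  have hg : ContinuousOn (fun s => (metric (F s) x).det) I :=
    continuousOn_det fun i j => by
      simp only [metric, Matrix.of_apply]
      exact (hd i).inner (hd j)
  have hs : ContinuousOn (fun s => (Real.sqrt (metric (F s) x).det)⁻¹) I :=
    (Real.continuous_sqrt.comp_continuousOn hg).inv₀ fun s hs =>
      (Real.sqrt_pos.2 (metric_det_pos (hG.orthonormal_tangent s hs x hx))).ne'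
  exact (hs.mul (continuousOn_ambDet hd (hν 0) (hν 1))).congr fun s _ => inner_rotJ _ _

/-- The orientation of the normal frame does not change in time. -/
theorem IsTemporalGauge.inner_rotJ_eq_one (hG : IsTemporalGauge I U F e ν) (hF : IsSMCF I F)
    (hI : I.OrdConnected) (hI' : I.Nontrivial) (ht : t ∈ I) (hx : x ∈ U) :
    (inner ℝ (rotJ (F t) x (ν 0 t x)) (ν 1 t x) : ℝ) = 1 := by
  obtain ⟨t₀, ht₀, h₀⟩ := hG.oriented
  refine eq_one_of_sq_eq_one (c := fun s => inner ℝ (rotJ (F s) x (ν 0 s x)) (ν 1 s x)) hI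
    (hG.continuousOn_inner_rotJ hF hI hI' hx) (fun s hs => ?_) ht₀ ?_ ht
  · exact inner_rotJ_sq (ν := fun α => ν α s x) (hG.orthonormal_tangent s hs x hx)
      (hG.orthonormal_normal s hs x hx) (hG.normal s hs x hx)
  · have h1 : ‖ν 1 t₀ x‖ = 1 := (hG.orthonormal_normal t₀ ht₀ x hx).1 1
    change inner ℝ (rotJ (F t₀) x (ν 0 t₀ x)) (ν 1 t₀ x) = (1 : ℝ)
    rw [h₀ x hx, real_inner_self_eq_norm_sq, h1, one_pow]

/-- As the normal frame stays positive, `rotJ` acts on normal vectors as `quarterTurn`. The velocity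
is thus expressed by the frame alone, so that its smoothness and its normal derivatives are at hand.
-/
theorem IsTemporalGauge.derivWithin_flow (hG : IsTemporalGauge I U F e ν) (hF : IsSMCF I F)
    (hU : IsOpen U) (hI : I.OrdConnected) (hI' : I.Nontrivial) (ht : t ∈ I) (hx : x ∈ U) :
    derivWithin (fun s => F s x) I t = frameVelocity F e ν t x := by
  have hS := hG.isFramed hF hU ht
  rw [(hF.flow t ht x).derivWithin (uniqueDiffOn_interval hI hI' t ht),
    meanCurvature_eq (hS.orthonormal_tangent x hx)]
  change rotJ (F t) x (frameMeanCurvature F e t x) = _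
  have h := hS.normal_eq_sum hx (hG.frameMeanCurvature_normal hF hU ht x hx)
  have h0 := rotJ_zero_eq (hS.orthonormal_tangent x hx) (hS.orthonormal_normal x hx)
    (hS.normal x hx)
  have h1 := rotJ_one_eq (hS.orthonormal_tangent x hx) (hS.orthonormal_normal x hx)
    (hS.normal x hx)
  have hc := hG.inner_rotJ_eq_one hF hI hI' ht hx
  rw [hc, one_smul] at h0 h1
  conv_lhs => rw [h, rotJ_add, rotJ_smul, rotJ_smul, h0, h1]
  rw [frameVelocity, quarterTurn]
  module

/-- With `V` the velocity, `∂_t(dF e_i) = D_{e_i}V + dF(∂_t e_i)`. The gauge makes the tangential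
part vanish, which determines `∂_t e_i` and leaves the normal part of `D_{e_i}V`. -/
theorem IsTemporalGauge.hasDerivWithinAt_frame (hG : IsTemporalGauge I U F e ν) (hF : IsSMCF I F)
    (hU : IsOpen U) (hI : I.OrdConnected) (hI' : I.Nontrivial) (ht : t ∈ I) (hx : x ∈ U)
    (i : Fin n) :
    HasDerivWithinAt (F := EuclideanSpace ℝ (Fin n)) (fun s => e i s x)
      (-tangentConn (F t) (e i t) (frameVelocity F e ν t) x) I t ∧
    derivWithin (fun s => differential (F s) x (e i s x)) I t =
      normalConn (F t) (e i t) (frameVelocity F e ν t) x := by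
  have hS := hG.isFramed hF hU ht
  have huniq := uniqueDiffOn_interval hI hI'
  have hL := hasDerivWithinAt_tderivModel (hF.contMDiffOn U) hU hI hI' ht hx
    (hG.smooth_frameVelocity hF hU ht) fun y hy => hG.derivWithin_flow hF hU hI hI' ht hy
  have hLc := contDiffOn_tderivModel (hF.contMDiffOn U) hU huniq hx
  have hEc : ContDiffOn ℝ ∞ (fun s => differential (F s) x (e i s x)) I := by
    have h := (contDiffOn_time_chart (ξ := fun s y => differential (F s) y (e i s y))
      (hG.smooth_tangent i) x).comp (contDiff_id.prodMk contDiff_const).contDiffOn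
      (s := I) fun s hs => ⟨hs, mem_chart_preimage (mem_extChartAt_source (I := 𝓡 n) x) hx⟩
    refine h.congr fun s hs => ?_
    change _ = (fun y => differential (F s) y (e i s y))
      ((extChartAt (𝓡 n) x).symm (extChartAt (𝓡 n) x x))
    rw [extChartAt_to_inv]
  -- Differentiability of `e_i` in time is not a hypothesis; it follows by solving for `e_i` in the
  -- smooth curve `dF(e_i)`.
  have he : HasDerivWithinAt (F := EuclideanSpace ℝ (Fin n)) (fun s => e i s x)
      (derivWithin (F := EuclideanSpace ℝ (Fin n)) (fun s => e i s x) I t) I t :=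
    ((contDiffWithinAt_of_clm_apply (V := EuclideanSpace ℝ (Fin n))
      (L := fun s => tderivModel n (F s) x) (e := fun s => (e i s x : EuclideanSpace ℝ (Fin n))) ht
      (hLc t ht) (hEc t ht) (fun _ _ => rfl)
      (hS.injective x hx)).differentiableWithinAt (by simp)).hasDerivWithinAt
  set c : EuclideanSpace ℝ (Fin n) :=
    derivWithin (F := EuclideanSpace ℝ (Fin n)) (fun s => e i s x) I t with hc
  have hprod := hL.clm_apply he
  let c' : TangentSpace (𝓡 n) x := c
  have h1 : derivWithin (fun s => differential (F s) x (e i s x)) I t =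
      dirDeriv (e i t) (frameVelocity F e ν t) x + differential (F t) x c' :=
    hprod.derivWithin (huniq t ht)
  have h2 : tangentConn (F t) (e i t) (frameVelocity F e ν t) x + c' = 0 := by
    have h := hG.parallel_tangent t ht x hx i
    rw [h1, tangentComp_eq_map, map_add] at h
    rw [← h]
    congr 1
    exact (tangentComp_differential (hS.orthonormal_tangent x hx) c').symm
  have h3 : c' = -tangentConn (F t) (e i t) (frameVelocity F e ν t) x :=
    eq_neg_of_add_eq_zero_right h2
  refine ⟨?_, ?_⟩
  · rw [← h3]
    exact he
  rw [h1, dirDeriv_eq_add (F t)]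
  have h4 : differential (F t) x c' = -differential (F t) x
      (tangentConn (F t) (e i t) (frameVelocity F e ν t) x) := by
    rw [← map_neg]
    exact congrArg _ h3
  rw [h4]
  abel

end FlowFrame

theorem sum_sub_mul_eq {ι : Type*} [Fintype ι] (a b : ℝ) (u v w : ι → ℝ) :
    ∑ m, (a * u m - b * v m) * w m = a * (∑ m, w m * u m) - b * ∑ m, w m * v m := by
  rw [Finset.mul_sum, Finset.mul_sum, ← Finset.sum_sub_distrib]
  exact Finset.sum_congr rfl fun m _ => by ring

/-! ### Evolution of the second fundamental form -/

section Evolution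

variable {n : ℕ} {M : Type*} [TopologicalSpace M] [ChartedSpace (EuclideanSpace ℝ (Fin n)) M]
  [IsManifold (𝓡 n) ∞ M]
  {I : Set ℝ} {U : Set M} {F : ℝ → M → Amb n}
  {e : Fin n → ℝ → (x : M) → TangentSpace (𝓡 n) x} {ν : Fin 2 → ℝ → M → Amb n} {t : ℝ} {x : M}

/-- Against a normal vector the projection in `A` can be dropped. What remains is differentiated in
time by the product rule, without differentiating the projection. -/
theorem IsTemporalGauge.coeffA_eq (hG : IsTemporalGauge I U F e ν) (hF : IsSMCF I F)
    (hU : IsOpen U) (ht : t ∈ I) (hx : x ∈ U) (α : Fin 2) (i j : Fin n) :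
    coeffA F e ν t x α i j = inner ℝ
      (dirDeriv (e i t) (fun y => differential (F t) y (e j t y)) x) (ν α t x) := by
  have hS := hG.isFramed hF hU ht
  rw [coeffA, hS.secondFF_eq_normalConn (hS.smooth_tangent j) hx]
  exact inner_normalPart (ν := fun α => ν α t x) (hS.normal x hx) _ α

theorem IsTemporalGauge.coeffA_symm (hG : IsTemporalGauge I U F e ν) (hF : IsSMCF I F)
    (hU : IsOpen U) (ht : t ∈ I) (hx : x ∈ U) (α : Fin 2) (i j : Fin n) :
    coeffA F e ν t x α i j = coeffA F e ν t x α j i := by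
  rw [coeffA, coeffA, (hG.isFramed hF hU ht).secondFF_symm hx]

theorem IsTemporalGauge.inner_derivWithin_normal (hG : IsTemporalGauge I U F e ν)
    (hF : IsSMCF I F) (hU : IsOpen U) (hI : I.OrdConnected) (hI' : I.Nontrivial) (ht : t ∈ I)
    (hx : x ∈ U) (α : Fin 2) (m : Fin n) :
    (inner ℝ (differential (F t) x (e m t x)) (derivWithin (fun s => ν α s x) I t) : ℝ) =
      -inner ℝ (normalConn (F t) (e m t) (frameVelocity F e ν t) x) (ν α t x) := by
  have h1 := hasDerivWithinAt_time (ξ := fun s y => differential (F s) y (e m s y))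
    (hG.smooth_tangent m) ht hx
  have h2 := hasDerivWithinAt_time (hG.smooth_normal α) ht hx
  have huniq := uniqueDiffOn_interval hI hI' t ht
  have h3 : HasDerivWithinAt
      (fun s => (inner ℝ (differential (F s) x (e m s x)) (ν α s x) : ℝ)) 0 I t := by
    refine (hasDerivWithinAt_const t I (0 : ℝ)).congr_of_mem (fun s hs => ?_) ht
    rw [real_inner_comm, hG.normal s hs x hx]
  have h4 := huniq.eq_deriv _ (h1.inner ℝ h2) h3
  rw [(hG.hasDerivWithinAt_frame hF hU hI hI' ht hx m).2] at h4
  linarith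

/-- Product rule in `⟨D_{e_i}(dF e_j), ν_α⟩`. The factor `dF e_j` contributes the iterated normal
derivative of the velocity, `ν_α` contributes the Levi-Civita correction that completes it to a
Hessian, and `e_i` contributes the sum over `m`. -/
theorem IsTemporalGauge.hasDerivWithinAt_coeffA (hG : IsTemporalGauge I U F e ν)
    (hF : IsSMCF I F) (hU : IsOpen U) (hI : I.OrdConnected) (hI' : I.Nontrivial) (ht : t ∈ I)
    (hx : x ∈ U) (α : Fin 2) (i j : Fin n) :
    HasDerivWithinAt (fun s => coeffA F e ν s x α i j)
      (inner ℝ (normalConn (F t) (e i t) (normalConn (F t) (e j t) (frameVelocity F e ν t)) x -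
          normalConn (F t) (leviCivita (F t) (e i t) (e j t)) (frameVelocity F e ν t) x) (ν α t x) +
        ∑ m, inner ℝ (frameVelocity F e ν t x) (secondFF (F t) x (e i t x) (e m t x)) *
          coeffA F e ν t x α m j) I t := by
  have hS := hG.isFramed hF hU ht
  have hV := hG.smooth_frameVelocity hF hU ht
  have he : ∀ k, SmoothField (F t) U (e k t) := hS.smooth_tangent
  have hE := hasDerivWithinAt_tderivModel (ξ := fun s y => differential (F s) y (e j s y))
    (hG.smooth_tangent j) hU hI hI' ht hx (hS.smooth_normalConn (he j) hV)
    fun y hy => (hG.hasDerivWithinAt_frame hF hU hI hI' ht hy j).2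
  have hei := (hG.hasDerivWithinAt_frame hF hU hI hI' ht hx i).1
  have hν := hasDerivWithinAt_time (hG.smooth_normal α) ht hx
  have hprod := ((hE.clm_apply hei).inner ℝ hν).congr_of_mem
    (fun s hs => hG.coeffA_eq hF hU hs hx α i j) ht
  refine hprod.congr_deriv ?_
  symm
  have hT : tangentConn (F t) (e i t) (frameVelocity F e ν t) x =
      -∑ m, (inner ℝ (frameVelocity F e ν t x) (secondFF (F t) x (e i t x) (e m t x)) : ℝ) •
        e m t x := by
    rw [hS.tangentConn_eq hV (hG.frameVelocity_normal ht) hx]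
    congr 1
    refine Finset.sum_congr rfl fun m _ => ?_
    rw [dirDeriv_eq_add (F t), inner_add_right, hG.frameVelocity_normal ht x hx, zero_add,
      ← hS.secondFF_eq_normalConn (he m) hx]
  set c : TangentSpace (𝓡 n) x := -tangentConn (F t) (e i t) (frameVelocity F e ν t) x with hc
  -- The term from `∂_t e_i`, which Weingarten's formula expresses through `A`.
  have h1 : (inner ℝ (tderiv n (fun y => differential (F t) y (e j t y)) x c) (ν α t x) : ℝ) =
      ∑ m, inner ℝ (frameVelocity F e ν t x) (secondFF (F t) x (e i t x) (e m t x)) *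
          coeffA F e ν t x α m j := by
    rw [hc, hT, neg_neg, map_sum, sum_inner]
    refine Finset.sum_congr rfl fun m _ => ?_
    rw [map_smul, real_inner_smul_left, hG.coeffA_eq hF hU ht hx]
    rfl
  -- The term from `∂_t ν_α`. This vector is tangent by the gauge, so it sees only the tangential
  -- part `∇_{e_i} e_j` of the derivative.
  have h2 : (inner ℝ (dirDeriv (e i t) (fun y => differential (F t) y (e j t y)) x)
      (derivWithin (fun s => ν α s x) I t) : ℝ) =
      -inner ℝ (normalConn (F t) (leviCivita (F t) (e i t) (e j t)) (frameVelocity F e ν t) x)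
        (ν α t x) := by
    have hpar := hG.parallel_normal t ht x hx α
    have hν' : derivWithin (fun s => ν α s x) I t =
        differential (F t) x (tangentComp (F t) x (derivWithin (fun s => ν α s x) I t)) :=
      sub_eq_zero.1 hpar
    have h3 : (inner ℝ (normalConn (F t) (e i t) (fun y => differential (F t) y (e j t y)) x)
        (derivWithin (fun s => ν α s x) I t) : ℝ) = 0 := by
      rw [hν']
      exact hS.inner_normalPart_eq_zero hx _ _
    have hΓ : leviCivita (F t) (e i t) (e j t) x = _ := hS.leviCivita_frame j hx
    have h4 : tangentConn (F t) (e i t) (fun y => differential (F t) y (e j t y)) x =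
      leviCivita (F t) (e i t) (e j t) x := rfl
    have h5 : normalConn (F t) (leviCivita (F t) (e i t) (e j t)) (frameVelocity F e ν t) x =
        ∑ m, (inner ℝ (dirDeriv (e i t) (fun y => differential (F t) y (e j t y)) x)
          (differential (F t) x (e m t x)) : ℝ) •
            normalConn (F t) (e m t) (frameVelocity F e ν t) x := by
      simp only [normalConn, dirDeriv_eq, hΓ, normalPart_eq, map_sum, map_smul]
    rw [dirDeriv_eq_add (F t), inner_add_left, h3, add_zero, h4, h5, hΓ]
    simp only [map_sum, map_smul, sum_inner, real_inner_smul_left]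
    rw [← Finset.sum_neg_distrib]
    refine Finset.sum_congr rfl fun m _ => ?_
    rw [hG.inner_derivWithin_normal hF hU hI hI' ht hx, mul_neg]
  have h6 : (inner ℝ (normalConn (F t) (e i t) (normalConn (F t) (e j t)
      (frameVelocity F e ν t)) x) (ν α t x) : ℝ) = inner ℝ (dirDeriv (e i t) (normalConn (F t) (e j t)
      (frameVelocity F e ν t)) x) (ν α t x) :=
    inner_normalPart (ν := fun α => ν α t x) (hS.normal x hx) _ α
  rw [inner_sub_left, h6, ← h1]
  have h7 : ∀ b : ℝ,
      inner ℝ (dirDeriv (e i t) (fun y => differential (F t) y (e j t y)) x)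
        (derivWithin (fun s => ν α s x) I t) = -b →
      inner ℝ (dirDeriv (e i t) (normalConn (F t) (e j t) (frameVelocity F e ν t)) x) (ν α t x) - b
        + inner ℝ (tderiv n (fun y => differential (F t) y (e j t y)) x c) (ν α t x) =
      inner ℝ (dirDeriv (e i t) (fun y => differential (F t) y (e j t y)) x)
        (derivWithin (fun s => ν α s x) I t) + inner ℝ (dirDeriv (e i t) (normalConn (F t) (e j t)
      (frameVelocity F e ν t)) x + tderiv n (fun y => differential (F t) y (e j t y)) x c)
        (ν α t x) := by
    intro b hb
    rw [hb, inner_add_left]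
    ring
  exact h7 _ h2

/-- The evolution of the second fundamental form under the flow, in temporal gauge. -/
theorem IsTemporalGauge.coeffA_evolution (hG : IsTemporalGauge I U F e ν)
    (hF : IsSMCF I F) (hU : IsOpen U) (hI : I.OrdConnected) (hI' : I.Nontrivial) (ht : t ∈ I)
    (hx : x ∈ U) (i j : Fin n) {h : Fin 2 → Fin n → Fin n → ℝ} (hh : h = coeffA F e ν t x) :
    HasDerivWithinAt (fun s => coeffA F e ν s x 0 i j)
      (-lapCoeffA F e ν t x 1 i j - cubicQ h 1 i j - traceH h 1 * (∑ k, h 0 i k * h 0 j k)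
        + traceH h 0 * (∑ k, h 0 i k * h 1 j k)) I t ∧
    HasDerivWithinAt (fun s => coeffA F e ν s x 1 i j)
      (lapCoeffA F e ν t x 0 i j + cubicQ h 0 i j - traceH h 1 * (∑ k, h 1 i k * h 0 j k)
        + traceH h 0 * (∑ k, h 1 i k * h 1 j k)) I t := by
  have hS := hG.isFramed hF hU ht
  have he : ∀ k, SmoothField (F t) U (e k t) := hS.smooth_tangent
  have hhess := hS.hessian_quarterTurn (Y := e j t) (he i)
    (hG.smooth_frameMeanCurvature hF hU ht) (hG.frameMeanCurvature_normal hF hU ht) hx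
  have hsim := fun α => hS.inner_laplaceA hx α i j (h := h) fun α i j => by rw [hh]; rfl
  set W := normalConn (F t) (e j t) (normalConn (F t) (e i t) (frameMeanCurvature F e t)) x -
    normalConn (F t) (leviCivita (F t) (e j t) (e i t)) (frameMeanCurvature F e t) x with hW
  have hsim' : ∀ α, (inner ℝ W (ν α t x) : ℝ) = lapCoeffA F e ν t x α i j + cubicQ h α i j := hsim
  -- The indices are exchanged because `inner_laplaceA` has the Hessian in the order `(e_j, e_i)`;
  -- the symmetry of `h` restores them at the end.
  have hder := fun α => hG.hasDerivWithinAt_coeffA hF hU hI hI' ht hx α j i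
  have hhess' : normalConn (F t) (e j t) (normalConn (F t) (e i t) (frameVelocity F e ν t)) x -
      normalConn (F t) (leviCivita (F t) (e j t) (e i t)) (frameVelocity F e ν t) x =
      quarterTurn (ν 0 t x) (ν 1 t x) W := hhess
  have hon : ∀ α β, (inner ℝ (ν α t x) (ν β t x) : ℝ) = if α = β then 1 else 0 :=
    hS.inner_normal_frame hx
  -- The turn exchanges the normal components, with a sign in this one only: hence `-Δ_g h^{n+2}` in
  -- the first equation and `+Δ_g h^{n+1}` in the second.
  have hq0 : ∀ w, (inner ℝ (quarterTurn (ν 0 t x) (ν 1 t x) w) (ν 0 t x) : ℝ) =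
      -inner ℝ w (ν 1 t x) := fun w => by
    simp only [quarterTurn, inner_sub_left, real_inner_smul_left, hon]
    simp
  have hq1 : ∀ w, (inner ℝ (quarterTurn (ν 0 t x) (ν 1 t x) w) (ν 1 t x) : ℝ) =
      inner ℝ w (ν 0 t x) := fun w => by
    simp only [quarterTurn, inner_sub_left, real_inner_smul_left, hon]
    simp
  have hVA : ∀ m, (inner ℝ (frameVelocity F e ν t x) (secondFF (F t) x (e j t x) (e m t x)) : ℝ) =
      traceH h 0 * h 1 j m - traceH h 1 * h 0 j m := by
    intro m
    rw [frameVelocity, quarterTurn, inner_sub_left, real_inner_smul_left, real_inner_smul_left,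
      inner_frameMeanCurvature, inner_frameMeanCurvature, real_inner_comm, hh,
      real_inner_comm _ (ν 0 t x)]
    rfl
  have hsymm : ∀ α a b, coeffA F e ν t x α a b = h α b a := fun α a b => by
    rw [hG.coeffA_symm hF hU ht hx, hh]
  simp only [hhess', hVA, hsymm] at hder
  have hcs : ∀ (α : Fin 2), ∀ s ∈ I, coeffA F e ν s x α i j = coeffA F e ν s x α j i :=
    fun α s hs => hG.coeffA_symm hF hU hs hx α i j
  have h0 := (hder 0).congr_of_mem (hcs 0) ht
  have h1 := (hder 1).congr_of_mem (hcs 1) ht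
  refine ⟨h0.congr_deriv ?_, h1.congr_deriv ?_⟩
  · rw [hq0, hsim', sum_sub_mul_eq]
    ring
  · rw [hq1, hsim', sum_sub_mul_eq]
    ring

end Evolution

/-! ### The nonlinearity as a real trilinear map -/

section CubicTerm

variable {n : ℕ}

/-- The real (`α = 0`) or imaginary (`α = 1`) part of an entry of a complex matrix. -/
def entryPart (α : Fin 2) (i j : Fin n) : Matrix (Fin n) (Fin n) ℂ →ₗ[ℝ] ℝ :=
  (![Complex.reLm, Complex.imLm] α) ∘ₗ Matrix.entryLinearMap ℝ ℂ i j

/-- The product of three linear forms. -/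
def formProd (f g k : Matrix (Fin n) (Fin n) ℂ →ₗ[ℝ] ℝ) :
    MultilinearMap ℝ (fun _ : Fin 3 => Matrix (Fin n) (Fin n) ℂ) ℝ :=
  (MultilinearMap.mkPiAlgebra ℝ (Fin 3) ℝ).compLinearMap ![f, g, k]

theorem formProd_apply (f g k : Matrix (Fin n) (Fin n) ℂ →ₗ[ℝ] ℝ) (A : Matrix (Fin n) (Fin n) ℂ) :
    formProd f g k ![A, A, A] = f A * g A * k A := by
  simp [formProd, MultilinearMap.compLinearMap_apply, Fin.prod_univ_three]

/-- The trilinear form whose restriction to the diagonal is `cubicQ`. -/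
def cubicForm (α : Fin 2) (i j : Fin n) :
    MultilinearMap ℝ (fun _ : Fin 3 => Matrix (Fin n) (Fin n) ℂ) ℝ :=
  (∑ m, ∑ β, ((∑ k, formProd (entryPart α i m) (entryPart β m k) (entryPart β k j))
      - ∑ k, formProd (entryPart α i m) (entryPart β m j) (entryPart β k k)))
    + (∑ m, ∑ k, ∑ β, (formProd (entryPart α m k) (entryPart β m k) (entryPart β i j)
      - formProd (entryPart α m k) (entryPart β k i) (entryPart β m j)))
    + ∑ β, ∑ k, ∑ l, (formProd (entryPart β i k) (entryPart β k l) (entryPart α l j)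
      - formProd (entryPart β i k) (entryPart α k l) (entryPart β l j))

/-- The trilinear form whose restriction to the diagonal is
`-H^1 h^α_{ik} h^0_{jk} + H^0 h^α_{ik} h^1_{jk}`. -/
def rotationForm (α : Fin 2) (i j : Fin n) :
    MultilinearMap ℝ (fun _ : Fin 3 => Matrix (Fin n) (Fin n) ℂ) ℝ :=
  (∑ m, ∑ k, formProd (entryPart 0 m m) (entryPart α i k) (entryPart 1 j k))
    - ∑ m, ∑ k, formProd (entryPart 1 m m) (entryPart α i k) (entryPart 0 j k)

/-- The cubic term of the Schrödinger system for the complex second fundamental form. -/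
def schrodingerCubic (n : ℕ) :
    MultilinearMap ℝ (fun _ : Fin 3 => Matrix (Fin n) (Fin n) ℂ) (Matrix (Fin n) (Fin n) ℂ) :=
  MultilinearMap.pi fun i => MultilinearMap.pi fun j =>
    -- As `-i (∂_t h^0 + i ∂_t h^1) = ∂_t h^1 - i ∂_t h^0`, the real part comes from the second
    -- evolution equation and the imaginary part from the negative of the first.
    (cubicForm 0 i j + rotationForm 1 i j).smulRight (1 : ℂ)
      + (cubicForm 1 i j - rotationForm 0 i j).smulRight Complex.I

variable {A : Matrix (Fin n) (Fin n) ℂ} {h : Fin 2 → Fin n → Fin n → ℝ}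

theorem cubicForm_apply (hA : ∀ α i j, entryPart α i j A = h α i j) (α : Fin 2) (i j : Fin n) :
    cubicForm α i j ![A, A, A] = cubicQ h α i j := by
  simp only [cubicForm, add_apply, sum_apply,
    sub_apply, formProd_apply, hA, cubicQ, traceH]
  congr 1
  · congr 1
    · refine Finset.sum_congr rfl fun m _ => ?_
      rw [Finset.mul_sum]
      refine Finset.sum_congr rfl fun β _ => ?_
      rw [mul_sub, Finset.mul_sum, Finset.mul_sum, Finset.mul_sum]
      simp only [mul_assoc]
    · refine Finset.sum_congr rfl fun m _ => Finset.sum_congr rfl fun k _ => ?_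
      rw [Finset.mul_sum]
      exact Finset.sum_congr rfl fun β _ => by ring
  · refine Finset.sum_congr rfl fun m _ => Finset.sum_congr rfl fun k _ => ?_
    rw [Finset.mul_sum]
    exact Finset.sum_congr rfl fun β _ => by ring

theorem rotationForm_apply (hA : ∀ α i j, entryPart α i j A = h α i j) (α : Fin 2)
    (i j : Fin n) : rotationForm α i j ![A, A, A] =
      -(traceH h 1 * (∑ k, h α i k * h 0 j k)) + traceH h 0 * (∑ k, h α i k * h 1 j k) := by
  simp only [rotationForm, sum_apply, sub_apply, formProd_apply, hA,
    traceH, Finset.sum_mul_sum, mul_assoc]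
  ring

theorem schrodingerCubic_apply (hA : ∀ α i j, entryPart α i j A = h α i j) (i j : Fin n) :
    schrodingerCubic n ![A, A, A] i j =
      ((cubicQ h 0 i j + (-(traceH h 1 * (∑ k, h 1 i k * h 0 j k))
        + traceH h 0 * (∑ k, h 1 i k * h 1 j k)) : ℝ) : ℂ) +
      ((cubicQ h 1 i j - (-(traceH h 1 * (∑ k, h 0 i k * h 0 j k))
        + traceH h 0 * (∑ k, h 0 i k * h 1 j k)) : ℝ) : ℂ) * Complex.I := by
  rw [← cubicForm_apply hA, ← cubicForm_apply hA, ← rotationForm_apply hA,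
    ← rotationForm_apply hA]
  change (cubicForm 0 i j ![A, A, A] + rotationForm 1 i j ![A, A, A]) • (1 : ℂ) +
    (cubicForm 1 i j ![A, A, A] - rotationForm 0 i j ![A, A, A]) • Complex.I = _
  rw [Complex.real_smul, Complex.real_smul, mul_one]

end CubicTerm

end SkewMCF

end

/-! ### Assembly of the evolution equations and the Schrödinger system -/

theorem mainTheorem3 (n : ℕ) :
    ∃ T : MultilinearMap ℝ (fun _ : Fin 3 => Matrix (Fin n) (Fin n) ℂ) (Matrix (Fin n) (Fin n) ℂ),
      ∀ (M : Type*) [TopologicalSpace M] [ChartedSpace (EuclideanSpace ℝ (Fin n)) M]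
        [IsManifold (𝓡 n) ∞ M] [SkewMCF.OrientedManifold n M]
        (I : Set ℝ) (_ : I.OrdConnected) (_ : I.Nontrivial)
        (F : ℝ → M → SkewMCF.Amb n) (_ : SkewMCF.IsSMCF I F)
        (U : Set M) (_ : IsOpen U)
        (e : Fin n → ℝ → (x : M) → TangentSpace (𝓡 n) x) (ν : Fin 2 → ℝ → M → SkewMCF.Amb n)
        (_ : SkewMCF.IsTemporalGauge I U F e ν)
        (h Δh : ℝ → M → Fin 2 → Fin n → Fin n → ℝ) (H : ℝ → M → Fin 2 → ℝ)
        (Φ ΔΦ : ℝ → M → Matrix (Fin n) (Fin n) ℂ)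
        (_ : h = SkewMCF.coeffA F e ν) (_ : Δh = SkewMCF.lapCoeffA F e ν)
        (_ : H = fun t x => SkewMCF.traceH (h t x))
        (_ : Φ = SkewMCF.hasimoto F e ν) (_ : ΔΦ = SkewMCF.lapHasimoto F e ν),
        ∀ t ∈ I, ∀ x ∈ U, ∀ i j : Fin n,
          HasDerivWithinAt (fun s => h s x 0 i j)
            (-Δh t x 1 i j - SkewMCF.cubicQ (h t x) 1 i j
              - H t x 1 * (∑ k, h t x 0 i k * h t x 0 j k)
              + H t x 0 * (∑ k, h t x 0 i k * h t x 1 j k)) I t ∧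
          HasDerivWithinAt (fun s => h s x 1 i j)
            (Δh t x 0 i j + SkewMCF.cubicQ (h t x) 0 i j
              - H t x 1 * (∑ k, h t x 1 i k * h t x 0 j k)
              + H t x 0 * (∑ k, h t x 1 i k * h t x 1 j k)) I t ∧
          DifferentiableWithinAt ℝ (fun s => Φ s x i j) I t ∧
          -Complex.I * derivWithin (fun s => Φ s x i j) I t =
            ΔΦ t x i j + T ![Φ t x, Φ t x, Φ t x] i j := by
  refine ⟨SkewMCF.schrodingerCubic n, ?_⟩
  intro M _ _ _ _ I hI hI' F hF U hU e ν hG h Δh H Φ ΔΦ hh hΔh hH hΦ hΔΦ t ht x hx i j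
  subst hH hΦ hΔΦ hΔh
  obtain ⟨h0, h1⟩ := hG.coeffA_evolution hF hU hI hI' ht hx i j (h := h t x) (by rw [hh])
  subst hh
  have hΦ : HasDerivWithinAt (fun s => SkewMCF.hasimoto F e ν s x i j) _ I t :=
    h0.ofReal_comp.add (h1.ofReal_comp.const_mul Complex.I)
  refine ⟨h0, h1, hΦ.differentiableWithinAt, ?_⟩
  have hA : ∀ α i j, SkewMCF.entryPart α i j (SkewMCF.hasimoto F e ν t x) =
      SkewMCF.coeffA F e ν t x α i j := by
    intro α i j
    fin_cases α
    · change (SkewMCF.hasimoto F e ν t x i j).re = SkewMCF.coeffA F e ν t x 0 i j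
      simp [SkewMCF.hasimoto]
    · change (SkewMCF.hasimoto F e ν t x i j).im = SkewMCF.coeffA F e ν t x 1 i j
      simp [SkewMCF.hasimoto]
  have hmul : ∀ a b : ℂ, -Complex.I * (a + Complex.I * b) = b - Complex.I * a := fun a b => by
    linear_combination (-b) * Complex.I_sq
  rw [hΦ.derivWithin (SkewMCF.uniqueDiffOn_interval hI hI' t ht),
    hmul, SkewMCF.schrodingerCubic_apply hA]
  simp only [SkewMCF.lapHasimoto, Matrix.of_apply]
  push_cast
  ring
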